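/- Let $k\in\tfrac12\mathbb Z$ and let $N\ge 1$ be an integer, with $4\mid N$ if $k\notin\mathbb Z$. Let $\chi:\Gamma_0(N)\to\{z\in\mathbb C:|z|=1\}$ be a character with $\chi\begin{pmatrix}1&1\\0&1\end{pmatrix}=\chi\begin{pmatrix}1&0\\N&1\end{pmatrix}=1$ (for example $\chi(\gamma)=\psi(d)$ for a Dirichlet character $\psi$ mod $N$, where $d$ is the lower right entry of $\gamma$). For $\gamma=\begin{pmatrix}a&b\\c&d\end{pmatrix}$ set $(f|_k\gamma)(\tau)=(c\tau+d)^{-k}f(\gamma\tau)$ if $k\in\mathbb Z$, and $(f|_k\gamma)(\tau)=\left(\frac cd\right)\varepsilon_d^{2k}(c\tau+d)^{-k}f(\gamma\tau)$ for $\gamma\in\Gamma_0(4)$ if $k\in\frac12+\mathbb Z$, where $\left(\frac cd\right)$ is the Kronecker symbol, $\varepsilon_d=1$ or $i$ according as $d\equiv1$ or $3$ mod $4$, and all powers are principal. A smooth $f:\mathbb H\to\mathbb C$ is a *harmonic Maass form of polynomial growth* of weight $k$ and character $\chi$ on $\Gamma_0(N)$ if $f|_k\gamma=\chi(\gamma)f$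 for all $\gamma\in\Gamma_0(N)$; if $\Delta_kf=0$, where, with $\tau=x+iy$, $\Delta_k=-y^2\left(\frac{\partial^2}{\partial x^2}+\frac{\partial^2}{\partial y^2}\right)+iky\left(\frac{\partial}{\partial x}+i\frac{\partial}{\partial y}\right)$; and if for each $\gamma\in\mathrm{SL}_2(\mathbb Z)$ there is $A\in\mathbb R$ with $(c\tau+d)^{-k}f(\gamma\tau)=O(y^A)$ as $y\to\infty$, uniformly in $x$. Let $f$ be such a form and let $g(\tau)=(f|w_N)(\tau)=N^{k/2}(N\tau)^{-k}f(-1/(N\tau))$. With $q=e^{2\pi i\tau}$ and, for real $\nu$ and $x>0$, $\Gamma(\nu,x)=\int_x^\infty t^{\nu-1}e^{-t}\,dt$, consider absolutely convergent Fourier expansions $$f(\tau)=\sum_{n\ge0}a^+(n)q^n+a^-(0)y^{1-k}+\sum_{n\ge1}a^-(n)\Gamma(1-k,4\pi ny)q^{-n},$$ $$g(\tau)=\sum_{n\ge0}b^+(n)q^n+b^-(0)y^{1-k}+\sum_{n\ge1}b^-(n)\Gamma(1-k,4\pi ny)q^{-n}.$$ If $k\ne1$, then $f$ and $g$ have such expansions.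 If $k=1$, assume that they do (that is, that no term in $\log y$ occurs in the constant terms); in this case only the sums $a^+(0)+a^-(0)$ and $b^+(0)+b^-(0)$ are determined, and the decomposition may be chosen arbitrarily. Then there are real $\mu_f^\pm$, $\mu_g^\pm$ with $a^\pm(n)=O(n^{\mu_f^\pm})$ and $b^\pm(n)=O(n^{\mu_g^\pm})$. Put $L^\pm(f,s)=\sum_{n\ge1}a^\pm(n)n^{-s}$, $W_\nu(s)=\int_0^\infty\Gamma(\nu,2x)e^xx^{s-1}\,dx$ for $\mathrm{Re}(s)>\max\{-\nu,0\}$, and $$\Lambda(f,s)=\left(\frac{\sqrt N}{2\pi}\right)^s\left(\Gamma(s)L^+(f,s)+W_{1-k}(s)L^-(f,s)\right)\qquad\text{for }\mathrm{Re}(s)>\max\{\mu_f^++1,\ \mu_f^-+1,\ k-1,\ 0\},$$ and define $\Lambda(g,s)$ in the same way from $b^\pm$. Then $\Lambda(f,s)$ and $\Lambda(g,s)$ continue meromorphically to $\mathbb C$. The function $\Lambda(f,s)$ is holomorphic outside $\{0,1,k-1,k\}$ and has at most simple poles at $s=0,1,k-1,k$, with residues $$-a^+(0),\qquad i^kb^-(0)N^{\frac{k-1}2},\qquad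 -a^-(0)N^{\frac{k-1}2},\qquad i^kb^+(0)$$ respectively; where some of the four points coincide, the residue is the sum of the corresponding values, and where the residue is $0$ the singularity is removable. Moreover, with $i^k=e^{\pi ik/2}$, $$\Lambda(f,s)=i^k\,\Lambda(g,k-s).$$ -/

import Mathlib

open Complex Filter Topology MeasureTheory Asymptotics
open scoped UpperHalfPlane ContDiff MatrixGroups

namespace HMF

noncomputable section

/-! Throughout, the weight is `k = m / 2` with `m : ℤ`. -/

/-- The Kronecker symbol `(c / d)` for odd `d`. -/
def kroneckerOdd (c d : ℤ) : ℤ :=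
  (if c < 0 ∧ d < 0 then -1 else 1) * jacobiSym c d.natAbs

/-- `ε_d`, for odd `d`: equal to `1` if `d ≡ 1 mod 4` and to `i` if `d ≡ 3 mod 4`. -/
def epsilonOdd (d : ℤ) : ℂ := if d % 4 = 1 then 1 else I

/-- The factor in front of `(cτ + d)^{-k} f(γτ)` in the weight `k = m / 2` slash operator:
it is `1` for integral `k` and `(c / d) ε_d^{2k}` for half-integral `k`. -/
def slashFactor (m : ℤ) (c d : ℤ) : ℂ :=
  if Even m then 1 else (kroneckerOdd c d : ℂ) * epsilonOdd d ^ m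

/-- `(cτ + d)^{-k} f(γτ)`, with the principal branch of the power. -/
def plainSlash (k : ℝ) (f : ℍ → ℂ) (γ : SL(2, ℤ)) (τ : ℍ) : ℂ :=
  (((γ 1 0 : ℤ) : ℂ) * (τ : ℂ) + ((γ 1 1 : ℤ) : ℂ)) ^ (-(k : ℂ)) * f (γ • τ)

/-- The weight `k = m / 2` slash operator (for odd `m` it is used for `γ ∈ Γ₀(4)` only). -/
def slash (m : ℤ) (f : ℍ → ℂ) (γ : SL(2, ℤ)) (τ : ℍ) : ℂ :=
  slashFactor m (γ 1 0) (γ 1 1) * plainSlash ((m : ℝ) / 2) f γ τ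

/-- A function on the upper half-plane in the real coordinates `(x, y)`, `τ = x + iy`. -/
def coord (f : ℍ → ℂ) (x y : ℝ) : ℂ := f (UpperHalfPlane.ofComplex ((x : ℂ) + (y : ℂ) * I))

/-- The weight `k` hyperbolic Laplacian
`Δ_k = -y² (∂²/∂x² + ∂²/∂y²) + i k y (∂/∂x + i ∂/∂y)`. -/
def hypLaplacian (k : ℝ) (f : ℍ → ℂ) (τ : ℍ) : ℂ :=
  -((τ.im : ℂ) ^ 2) * (iteratedDeriv 2 (fun x : ℝ => coord f x τ.im) τ.re
      + iteratedDeriv 2 (fun y : ℝ => coord f τ.re y) τ.im)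
    + I * (k : ℂ) * (τ.im : ℂ) * (deriv (fun x : ℝ => coord f x τ.im) τ.re
      + I * deriv (fun y : ℝ => coord f τ.re y) τ.im)

/-- Harmonic Maass forms of polynomial growth, of weight `m / 2`, level `N` and (unitary)
character `χ` of `Γ₀(N)`. -/
structure IsHarmonicMaassForm (m : ℤ) (N : ℕ) (χ : CongruenceSubgroup.Gamma0 N →* Circle)
    (f : ℍ → ℂ) : Prop where
  smooth : ContDiffOn ℝ ∞ (fun z : ℂ => f (UpperHalfPlane.ofComplex z)) {z : ℂ | 0 < z.im}
  transform : ∀ (γ : CongruenceSubgroup.Gamma0 N) (τ : ℍ),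
    slash m f (γ : SL(2, ℤ)) τ = (χ γ : ℂ) * f τ
  harmonic : ∀ τ : ℍ, hypLaplacian ((m : ℝ) / 2) f τ = 0
  /-- At every cusp `γ∞`, `(cτ + d)^{-k} f(γτ) = O(y^A)` as `y → ∞`, uniformly in `x`. -/
  growth : ∀ γ : SL(2, ℤ), ∃ A : ℝ,
    plainSlash ((m : ℝ) / 2) f γ =O[UpperHalfPlane.atImInfty] fun τ : ℍ => τ.im ^ A

/-- The Fricke involution `(f | w_N)(τ) = N^{k/2} (Nτ)^{-k} f(-1/(Nτ))`. -/
def fricke (k : ℝ) (N : ℕ) (f : ℍ → ℂ) (τ : ℍ) : ℂ :=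
  (N : ℂ) ^ ((k : ℂ) / 2) * ((N : ℂ) * (τ : ℂ)) ^ (-(k : ℂ))
    * f (UpperHalfPlane.ofComplex (-1 / ((N : ℂ) * (τ : ℂ))))

/-- The incomplete Gamma function `Γ(ν, x) = ∫_x^∞ t^{ν-1} e^{-t} dt`, for real `ν` and `x > 0`. -/
def incGamma (ν x : ℝ) : ℝ := ∫ t in Set.Ioi x, t ^ (ν - 1) * Real.exp (-t)

/-- `W_ν(s) = ∫_0^∞ Γ(ν, 2x) e^x x^{s-1} dx`, for `Re s > max(-ν, 0)`. -/
def W (ν : ℝ) (s : ℂ) : ℂ :=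
  ∫ x in Set.Ioi (0 : ℝ), ((incGamma ν (2 * x) * Real.exp x : ℝ) : ℂ) * (x : ℂ) ^ (s - 1)

/-- `q^n` with `q = e^{2πiτ}`, for `n : ℤ`. -/
def qpow (n : ℤ) (τ : ℍ) : ℂ := Complex.exp (2 * Real.pi * I * n * (τ : ℂ))

/-- The terms `c⁻(n) Γ(1-k, 4πny) q^{-n}` of the non-holomorphic part (used for `n ≥ 1`). -/
def minusTerm (k : ℝ) (am : ℕ → ℂ) (n : ℕ) (τ : ℍ) : ℂ :=
  am n * (incGamma (1 - k) (4 * Real.pi * n * τ.im) : ℂ) * qpow (-(n : ℤ)) τ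

/-- `f(τ) = ∑_{n ≥ 0} a⁺(n) qⁿ + a⁻(0) y^{1-k} + ∑_{n ≥ 1} a⁻(n) Γ(1-k, 4πny) q^{-n}`,
both series being absolutely convergent on the upper half-plane. -/
structure HasExpansion (k : ℝ) (f : ℍ → ℂ) (ap am : ℕ → ℂ) : Prop where
  summable_plus : ∀ τ : ℍ, Summable fun n : ℕ => ap n * qpow n τ
  summable_minus : ∀ τ : ℍ, Summable fun n : ℕ => minusTerm k am (n + 1) τ
  eq : ∀ τ : ℍ, f τ = (∑' n : ℕ, ap n * qpow n τ) + am 0 * ((τ.im ^ (1 - k) : ℝ) : ℂ)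
    + ∑' n : ℕ, minusTerm k am (n + 1) τ

/-- `(√N / 2π)^s (Γ(s) L⁺(s) + W_{1-k}(s) L⁻(s))`, where `L^±(s) = ∑_{n ≥ 1} a^±(n) n^{-s}`. -/
def completedL (N : ℕ) (k : ℝ) (ap am : ℕ → ℂ) (s : ℂ) : ℂ :=
  ((Real.sqrt N / (2 * Real.pi) : ℝ) : ℂ) ^ s
    * (Complex.Gamma s * LSeries ap s + W (1 - k) s * LSeries am s)

/-- `a(n) = O(n^μ)` as `n → ∞`. -/
def PolyBound (a : ℕ → ℂ) (μ : ℝ) : Prop := a =O[atTop] fun n : ℕ => (n : ℝ) ^ μ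

/-- `F` is meromorphic on `ℂ` and equals the completed `L`-function with coefficients `a^±`
on each half-plane `Re s > max(μ⁺ + 1, μ⁻ + 1, k - 1, 0)` with `a^±(n) = O(n^{μ^±})`. -/
def IsContinuation (N : ℕ) (k : ℝ) (ap am : ℕ → ℂ) (F : ℂ → ℂ) : Prop :=
  (∀ s : ℂ, MeromorphicAt F s) ∧
  ∀ μp μm : ℝ, PolyBound ap μp → PolyBound am μm →
    ∀ s : ℂ, max (max (μp + 1) (μm + 1)) (max (k - 1) 0) < s.re → F s = completedL N k ap am s

/-- The residue at `p`: the sum of the contributions of those of the points `0, 1, k-1, k` that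
are equal to `p` (these four points need not be distinct). -/
def residueAt (N : ℕ) (k : ℝ) (ap0 am0 bp0 bm0 : ℂ) (p : ℂ) : ℂ :=
  open Classical in
  (if p = 0 then -ap0 else 0)
    + (if p = 1 then I ^ (k : ℂ) * bm0 * (N : ℂ) ^ (((k : ℂ) - 1) / 2) else 0)
    + (if p = (k : ℂ) - 1 then -am0 * (N : ℂ) ^ (((k : ℂ) - 1) / 2) else 0)
    + (if p = (k : ℂ) then I ^ (k : ℂ) * bp0 else 0)

end

end HMF

/-!
The proof has two parts.

**Fourier expansion and bounds.** The operator `Δ_k` factors as `-y^{2-k} (∂_x - i∂_y) y^k (∂_x +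
i∂_y)`, so `Δ_k f = 0` says that the shadow `y^k (∂_x + i∂_y) f` is antiholomorphic
(`isHarmonic_ext_of_hypLaplacian`). The values of `χ` at the two unipotent matrices make both `f`
and its Fricke image `g` periodic, and `g` is again harmonic since the conjugate of its shadow is
a holomorphic multiple of that of `f` at `-1/(Nτ)` (`isHarmonic_fricke`). Hence the `j`-th Fourier
coefficient `c(y)` of either function and the coefficient `u(y)` of its shadow satisfy a first
order system (`isCoefODE_fourierCoef`), whose solutions are spanned by two explicit functions. One
of them grows exponentially if `j ≠ 0`, and polynomial growth excludes it; if `j = 0` and `k ≠ 1`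
they are `1` and `y^{1-k}`. Polynomial growth comes from `y^{k/2} |f|`, which is invariant under
`Γ₀(N)` and is therefore bounded by a power of `max(y, 1/y)`
(`IsHarmonicMaassForm.exists_invNorm_le`). Evaluating the Fourier coefficients at height `1/n`
bounds `a^±(n)` polynomially, which in turn makes the Fourier series converge absolutely
(`HasFourierCoefs.exists_polyBound`, `HasFourierCoefs.hasExpansion`).

**Continuation.** Put `F(y) = f(iy/√N)` and `G(y) = g(iy/√N)`. By the definition of `g`, `F(1/y) =
i^k y^k G(y)` (`axis_inv`), and `F` differs from `a⁺(0) + a⁻(0) N^{(k-1)/2} y^{1-k}` by an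
exponentially small amount as `y → ∞` (`isBigO_subConst_axis`). Far to the right the Mellin
transform of this difference is `Λ(f, s)`, term by term (`mellin_subConst_axis`). Splitting the
integral at `1` and replacing `y` by `1/y` on `(0, 1)` gives two entire integrals over `(1, ∞)`
and the integrals of four powers of `y` over `(0, 1]`; these are the polar terms at `0, 1, k-1, k`
(`IsFEPair.mellin_eq`). The resulting expression is visibly compatible with `s ↦ k - s` and `F ↔ G`
(`IsFEPair.continuation_eq`). The identity theorem gives equality with `Λ(f, s)` on the whole
half-plane in question (`IsFEPair.eq_continuation_of_eq`).
-/

namespace HMF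

/-! ### The incomplete Gamma function -/

lemma integrableOn_incGamma (ν : ℝ) {x : ℝ} (hx : 0 < x) :
    IntegrableOn (fun t : ℝ => t ^ (ν - 1) * Real.exp (-t)) (Set.Ioi x) := by
  refine integrable_of_isBigO_exp_neg (b := 1 / 2) (by norm_num) ?_ ?_
  · intro t ht
    have ht : x ≤ t := ht
    have h0 : t ≠ 0 := by linarith
    exact ((Real.continuousAt_rpow_const t _ (Or.inl h0)).mul (by fun_prop)).continuousWithinAt
  · simpa [mul_comm] using (Real.Gamma_integrand_isLittleO (ν - 1)).isBigO

lemma hasDerivAt_incGamma (ν : ℝ) {x : ℝ} (hx : 0 < x) :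
    HasDerivAt (incGamma ν) (-(x ^ (ν - 1) * Real.exp (-x))) x := by
  have hcont : ∀ t : ℝ, 0 < t → ContinuousAt (fun t : ℝ => t ^ (ν - 1) * Real.exp (-t)) t :=
    fun t ht => (Real.continuousAt_rpow_const t _ (Or.inl ht.ne')).mul (by fun_prop)
  have hcO : ContinuousOn (fun t : ℝ => t ^ (ν - 1) * Real.exp (-t)) (Set.Ioi 0) :=
    fun t ht => (hcont t ht).continuousWithinAt
  have hd : HasDerivAt (fun u => ∫ t in x..u, t ^ (ν - 1) * Real.exp (-t))
      (x ^ (ν - 1) * Real.exp (-x)) x :=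
    intervalIntegral.integral_hasDerivAt_right (by simp)
      (hcO.stronglyMeasurableAtFilter isOpen_Ioi x hx) (hcont x hx)
  refine (hd.const_sub (incGamma ν x)).congr_of_eventuallyEq ?_
  filter_upwards [Ioi_mem_nhds hx] with u hu
  have := intervalIntegral.integral_interval_add_Ioi (integrableOn_incGamma ν hx)
    (integrableOn_incGamma ν hu)
  simp only [incGamma]
  linarith

lemma continuousOn_incGamma (ν : ℝ) : ContinuousOn (incGamma ν) (Set.Ioi 0) :=
  fun _ hx => (hasDerivAt_incGamma ν hx).continuousAt.continuousWithinAt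

lemma incGamma_pos (ν : ℝ) {x : ℝ} (hx : 0 < x) : 0 < incGamma ν x := by
  rw [incGamma, setIntegral_pos_iff_support_of_nonneg_ae]
  · have : Function.support (fun t : ℝ => t ^ (ν - 1) * Real.exp (-t)) ∩ Set.Ioi x = Set.Ioi x := by
      refine Set.inter_eq_right.2 fun t ht => ?_
      have : 0 < t := hx.trans ht
      simp only [Function.mem_support]
      positivity
    rw [this]
    simp
  · filter_upwards [ae_restrict_mem measurableSet_Ioi] with t ht
    have : 0 < t := hx.trans ht
    simp only [Pi.zero_apply]
    positivity
  · exact integrableOn_incGamma ν hx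

/-- The weight `(t / 2x)^σ ≥ 1` on `t ≥ 2x` makes the integrand integrable at `0`, at the cost of a
factor `x^{-σ}`. -/
lemma exists_incGamma_le (ν σ : ℝ) (hσ : 0 ≤ σ) (hσν : 0 < σ + ν) :
    ∃ C : ℝ, ∀ x : ℝ, 0 < x →
      incGamma ν (2 * x) * Real.exp x ≤ C * x ^ (-σ) * Real.exp (-x / 2) := by
  have hint : IntegrableOn (fun t : ℝ => t ^ (σ + ν - 1) * Real.exp (-(1 / 4) * t))
      (Set.Ioi 0) := by
    simpa using integrableOn_rpow_mul_exp_neg_mul_rpow (p := 1) (s := σ + ν - 1) (b := 1 / 4)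
      (by linarith) one_pos (by norm_num)
  refine ⟨∫ t in Set.Ioi (0 : ℝ), t ^ (σ + ν - 1) * Real.exp (-(1 / 4) * t), fun x hx => ?_⟩
  have hsub : Set.Ioi (2 * x) ⊆ Set.Ioi (0 : ℝ) := Set.Ioi_subset_Ioi (by linarith)
  have hnn : ∀ t ∈ Set.Ioi (0 : ℝ), 0 ≤ t ^ (σ + ν - 1) * Real.exp (-(1 / 4) * t) := by
    intro t ht
    have : 0 < t := ht
    positivity
  calc incGamma ν (2 * x) * Real.exp x
      = ∫ t in Set.Ioi (2 * x), t ^ (ν - 1) * Real.exp (-t) * Real.exp x := by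
        rw [incGamma, integral_mul_const]
    _ ≤ ∫ t in Set.Ioi (2 * x), t ^ (σ + ν - 1) * Real.exp (-(1 / 4) * t)
          * (x ^ (-σ) * Real.exp (-x / 2)) := by
        refine setIntegral_mono_on ((integrableOn_incGamma ν (by linarith)).mul_const _)
          ((hint.mono_set hsub).mul_const _) measurableSet_Ioi fun t ht => ?_
        have htx : 2 * x < t := ht
        have ht0 : 0 < t := by linarith
        have h1 : t ^ (ν - 1) ≤ t ^ (σ + ν - 1) * x ^ (-σ) := by
          rw [show σ + ν - 1 = (ν - 1) + σ by ring, Real.rpow_add ht0, Real.rpow_neg hx.le,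
            mul_assoc]
          refine le_mul_of_one_le_right (by positivity) ?_
          rw [← div_eq_mul_inv, ← Real.div_rpow ht0.le hx.le]
          refine Real.one_le_rpow ?_ hσ
          rw [le_div_iff₀ hx]; linarith
        have h2 : Real.exp (-t) * Real.exp x ≤ Real.exp (-(1 / 4) * t) * Real.exp (-x / 2) := by
          rw [← Real.exp_add, ← Real.exp_add]
          exact Real.exp_le_exp.2 (by linarith)
        calc t ^ (ν - 1) * Real.exp (-t) * Real.exp x
            = t ^ (ν - 1) * (Real.exp (-t) * Real.exp x) := by ring
          _ ≤ (t ^ (σ + ν - 1) * x ^ (-σ)) * (Real.exp (-(1 / 4) * t) * Real.exp (-x / 2)) := by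
            gcongr
          _ = _ := by ring
    _ = (∫ t in Set.Ioi (2 * x), t ^ (σ + ν - 1) * Real.exp (-(1 / 4) * t))
          * (x ^ (-σ) * Real.exp (-x / 2)) := integral_mul_const _ _
    _ ≤ (∫ t in Set.Ioi (0 : ℝ), t ^ (σ + ν - 1) * Real.exp (-(1 / 4) * t))
          * (x ^ (-σ) * Real.exp (-x / 2)) := by
        gcongr
        · exact (ae_restrict_iff' measurableSet_Ioi).2 (Eventually.of_forall hnn)
    _ = _ := by ring

/-! ### Mellin transforms of generalised Dirichlet series -/

/-- A continuous function on `(0, ∞)` bounded by a multiple of `x^{-σ} e^{-x/2}`: the common shape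
of `e^{-x}` and of `Γ(ν, 2x) e^x`, whose dilates `x = cny` make up the Fourier expansions
on the imaginary axis. -/
structure IsKernel (σ : ℝ) (φ : ℝ → ℂ) : Prop where
  continuousOn : ContinuousOn φ (Set.Ioi 0)
  bound : ∃ C : ℝ, ∀ x : ℝ, 0 < x → ‖φ x‖ ≤ C * x ^ (-σ) * Real.exp (-x / 2)

lemma isKernel_exp : IsKernel 0 (fun x => (Real.exp (-x) : ℂ)) where
  continuousOn := by fun_prop
  bound := by
    refine ⟨1, fun x hx => ?_⟩
    rw [Complex.norm_real, Real.norm_eq_abs, Real.abs_exp]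
    simp
    linarith

lemma isKernel_incGamma (ν σ : ℝ) (hσ : 0 ≤ σ) (hσν : 0 < σ + ν) :
    IsKernel σ (fun x => ((incGamma ν (2 * x) * Real.exp x : ℝ) : ℂ)) where
  continuousOn := by
    refine continuous_ofReal.comp_continuousOn (ContinuousOn.mul ?_ (by fun_prop))
    refine (continuousOn_incGamma ν).comp (by fun_prop) fun x hx => ?_
    have : 0 < x := hx
    simpa using this
  bound := by
    obtain ⟨C, hC⟩ := exists_incGamma_le ν σ hσ hσν
    refine ⟨C, fun x hx => ?_⟩
    rw [Complex.norm_real, Real.norm_of_nonneg]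
    · exact hC x hx
    · have := incGamma_pos ν (x := 2 * x) (by linarith)
      positivity

namespace IsKernel

variable {σ : ℝ} {φ : ℝ → ℂ}

lemma locallyIntegrableOn (h : IsKernel σ φ) : LocallyIntegrableOn φ (Set.Ioi 0) :=
  h.continuousOn.locallyIntegrableOn measurableSet_Ioi

lemma isBigO_zero (h : IsKernel σ φ) : φ =O[𝓝[>] 0] fun x : ℝ => x ^ (-σ) := by
  obtain ⟨C, hC⟩ := h.bound
  refine IsBigO.of_bound |C| ?_
  filter_upwards [self_mem_nhdsWithin] with x hx
  have hx : 0 < x := hx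
  rw [Real.norm_of_nonneg (by positivity)]
  calc ‖φ x‖ ≤ C * x ^ (-σ) * Real.exp (-x / 2) := hC x hx
    _ ≤ |C| * x ^ (-σ) * 1 := by
      gcongr
      · exact le_abs_self C
      · rw [Real.exp_le_one_iff]; linarith
    _ = _ := mul_one _

lemma isBigO_atTop (h : IsKernel σ φ) : φ =O[atTop] fun x : ℝ => Real.exp (-(1 / 4) * x) := by
  obtain ⟨C, hC⟩ := h.bound
  have h1 : φ =O[atTop] fun x : ℝ => x ^ (-σ) * Real.exp (-(1 / 2) * x) := by
    refine IsBigO.of_bound |C| ?_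
    filter_upwards [eventually_gt_atTop 0] with x hx
    rw [Real.norm_of_nonneg (by positivity)]
    calc ‖φ x‖ ≤ C * x ^ (-σ) * Real.exp (-x / 2) := hC x hx
      _ ≤ |C| * x ^ (-σ) * Real.exp (-x / 2) := by
        gcongr
        exact le_abs_self C
      _ = _ := by rw [mul_assoc]; congr 3; ring
  refine h1.trans ?_
  refine ((isLittleO_rpow_exp_pos_mul_atTop (-σ) (b := 1 / 4) (by norm_num)).isBigO.mul
    (isBigO_refl (fun x : ℝ => Real.exp (-(1 / 2) * x)) atTop)).congr_right fun x => ?_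
  rw [← Real.exp_add]; congr 1; ring

lemma mellinConvergent (h : IsKernel σ φ) {s : ℂ} (hs : σ < s.re) : MellinConvergent φ s :=
  mellinConvergent_of_isBigO_rpow_exp (a := 1 / 4) (by norm_num) h.locallyIntegrableOn
    h.isBigO_atTop h.isBigO_zero hs

lemma differentiableAt_mellin (h : IsKernel σ φ) {s : ℂ} (hs : σ < s.re) :
    DifferentiableAt ℂ (mellin φ) s :=
  mellin_differentiableAt_of_isBigO_rpow_exp (a := 1 / 4) (by norm_num) h.locallyIntegrableOn
    h.isBigO_atTop h.isBigO_zero hs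

/-- Uniform decay of the dilates `φ(c n y)` for `y` bounded away from `0`. -/
lemma exists_norm_dilate_le (h : IsKernel σ φ) (hσ : 0 ≤ σ) {c y₀ : ℝ} (hc : 0 < c)
    (hy₀ : 0 < y₀) : ∃ (C δ : ℝ), 0 ≤ C ∧ 0 < δ ∧ ∀ (n : ℕ) (y : ℝ), y₀ ≤ y →
      ‖φ (c * (n + 1 : ℕ) * y)‖ ≤ C * (Real.exp (-δ * (n + 1 : ℕ)) * Real.exp (-(c / 4) * y)) := by
  obtain ⟨C, hC⟩ := h.bound
  refine ⟨|C| * (c * y₀) ^ (-σ), c * y₀ / 4, by positivity, by positivity, fun n y hy => ?_⟩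
  have hy0 : 0 < y := hy₀.trans_le hy
  have hn : (1 : ℝ) ≤ (n + 1 : ℕ) := by push_cast; linarith [n.cast_nonneg (α := ℝ)]
  set t : ℝ := ((n + 1 : ℕ) : ℝ) with ht
  have h1 : c * y₀ ≤ c * t * y := by
    calc c * y₀ = c * 1 * y₀ := by ring
      _ ≤ c * t * y := by gcongr
  calc ‖φ (c * t * y)‖ ≤ C * (c * t * y) ^ (-σ) * Real.exp (-(c * t * y) / 2) :=
        hC _ (by positivity)
    _ ≤ |C| * (c * y₀) ^ (-σ)
          * (Real.exp (-(c * y₀ / 4) * t) * Real.exp (-(c / 4) * y)) := by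
        gcongr ?_ * ?_ * ?_
        · exact le_abs_self C
        · exact Real.rpow_le_rpow_of_nonpos (by positivity) h1 (by linarith)
        · rw [← Real.exp_add, Real.exp_le_exp]
          have : y₀ * t + y ≤ 2 * (t * y) := by nlinarith
          nlinarith
    _ = _ := by ring

lemma integrableOn_dilate (h : IsKernel σ φ) {c : ℝ} (hc : 0 < c) {s : ℂ} (hs : σ < s.re)
    (a : ℂ) (n : ℕ) :
    IntegrableOn (fun y : ℝ => (y : ℂ) ^ (s - 1) • (a * φ (c * (n + 1 : ℕ) * y)))
      (Set.Ioi 0) := by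
  have : MellinConvergent (fun y : ℝ => a • φ (c * (n + 1 : ℕ) * y)) s :=
    ((MellinConvergent.comp_mul_left (by positivity)).2 (h.mellinConvergent hs)).const_smul a
  exact this

lemma integral_dilate (φ : ℝ → ℂ) {c : ℝ} (hc : 0 < c) (s a : ℂ) (n : ℕ) :
    ∫ y : ℝ in Set.Ioi 0, (y : ℂ) ^ (s - 1) • (a * φ (c * (n + 1 : ℕ) * y))
      = (c : ℂ) ^ (-s) * mellin φ s * (a / ((n + 1 : ℕ) : ℂ) ^ s) := by
  have h1 := mellin_const_smul (fun y : ℝ => φ (c * (n + 1 : ℕ) * y)) s a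
  rw [mellin_comp_mul_left φ s (by positivity : 0 < c * ((n + 1 : ℕ) : ℝ))] at h1
  simp only [mellin, smul_eq_mul] at h1 ⊢
  rw [h1, ofReal_mul, mul_cpow_ofReal_nonneg hc.le (by positivity), cpow_neg _ s,
    Complex.cpow_neg ((((n + 1 : ℕ) : ℝ)) : ℂ) s]
  push_cast
  ring

/-- The integrals of the norms are the same Mellin integrals for `‖a n‖`, `‖φ‖` and `Re s`. -/
lemma summable_integral_norm_dilate (φ : ℝ → ℂ) {c : ℝ} (hc : 0 < c) {s : ℂ}
    {a : ℕ → ℂ} (ha : LSeriesSummable a s) :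
    Summable fun n : ℕ => ∫ y : ℝ in Set.Ioi 0,
      ‖(y : ℂ) ^ (s - 1) • (a (n + 1) * φ (c * (n + 1 : ℕ) * y))‖ := by
  have key : ∀ n : ℕ, ∫ y : ℝ in Set.Ioi 0,
      ‖(y : ℂ) ^ (s - 1) • (a (n + 1) * φ (c * (n + 1 : ℕ) * y))‖
      = ‖(c : ℂ) ^ (-(s.re : ℂ)) * mellin (fun x => (‖φ x‖ : ℂ)) s.re‖ *
        ‖LSeries.term a s (n + 1)‖ := by
    intro n
    have h2 := integral_dilate (fun x => (‖φ x‖ : ℂ)) hc s.re (‖a (n + 1)‖ : ℂ) n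
    have h3 : ∫ y : ℝ in Set.Ioi 0, (y : ℂ) ^ ((s.re : ℂ) - 1) •
        ((‖a (n + 1)‖ : ℂ) * (‖φ (c * (n + 1 : ℕ) * y)‖ : ℂ)) =
        ((∫ y : ℝ in Set.Ioi 0,
          ‖(y : ℂ) ^ (s - 1) • (a (n + 1) * φ (c * (n + 1 : ℕ) * y))‖ : ℝ) : ℂ) := by
      rw [← integral_complex_ofReal]
      refine setIntegral_congr_fun measurableSet_Ioi fun y hy => ?_
      have hy : 0 < y := hy
      simp only [norm_mul, smul_eq_mul]
      rw [norm_cpow_eq_rpow_re_of_pos hy]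
      push_cast
      rw [ofReal_cpow hy.le]
      simp
    rw [h3] at h2
    have h4 := congrArg (fun z : ℂ => ‖z‖) h2
    rw [Complex.norm_real, Real.norm_of_nonneg (integral_nonneg fun _ => norm_nonneg _)] at h4
    rw [h4, norm_mul]
    congr 1
    rw [LSeries.term_of_ne_zero (by omega), norm_div, norm_div, Complex.norm_real, norm_norm,
      Complex.norm_natCast_cpow_of_pos (by omega), Complex.norm_natCast_cpow_of_pos (by omega)]
    simp
  simp_rw [key]
  exact (((summable_nat_add_iff 1).2 ha).norm).mul_left _

end IsKernel

/-- Term-by-term Mellin transform of `∑ (a(n) φ(cny) + b(n) ψ(cny))`. -/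
lemma mellin_dirichlet {σ τ c : ℝ} {φ ψ : ℝ → ℂ} (hφ : IsKernel σ φ) (hψ : IsKernel τ ψ)
    (hc : 0 < c) {a b : ℕ → ℂ} {s : ℂ} (hs : σ < s.re) (hs' : τ < s.re)
    (ha : LSeriesSummable a s) (hb : LSeriesSummable b s) :
    mellin (fun y : ℝ => ∑' n : ℕ, (a (n + 1) * φ (c * (n + 1 : ℕ) * y)
      + b (n + 1) * ψ (c * (n + 1 : ℕ) * y))) s
      = (c : ℂ) ^ (-s) * (mellin φ s * LSeries a s + mellin ψ s * LSeries b s) := by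
  have h1 := hasSum_integral_of_summable_integral_norm (μ := volume.restrict (Set.Ioi 0))
    (F := fun (n : ℕ) (y : ℝ) => (y : ℂ) ^ (s - 1) • (a (n + 1) * φ (c * (n + 1 : ℕ) * y))
      + (y : ℂ) ^ (s - 1) • (b (n + 1) * ψ (c * (n + 1 : ℕ) * y)))
    (fun n => (hφ.integrableOn_dilate hc hs _ n).add (hψ.integrableOn_dilate hc hs' _ n)) ?_
  · have h2 : ∀ n : ℕ, ∫ y : ℝ in Set.Ioi 0,
        ((y : ℂ) ^ (s - 1) • (a (n + 1) * φ (c * (n + 1 : ℕ) * y))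
        + (y : ℂ) ^ (s - 1) • (b (n + 1) * ψ (c * (n + 1 : ℕ) * y)))
        = (c : ℂ) ^ (-s) * mellin φ s * LSeries.term a s (n + 1)
          + (c : ℂ) ^ (-s) * mellin ψ s * LSeries.term b s (n + 1) := by
      intro n
      rw [integral_add (hφ.integrableOn_dilate hc hs _ n) (hψ.integrableOn_dilate hc hs' _ n),
        IsKernel.integral_dilate φ hc, IsKernel.integral_dilate ψ hc,
        LSeries.term_of_ne_zero (by omega), LSeries.term_of_ne_zero (by omega)]
    have hL : ∀ {a : ℕ → ℂ}, LSeriesSummable a s →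
        HasSum (fun n => LSeries.term a s (n + 1)) (LSeries a s) := by
      intro a ha
      have := (hasSum_nat_add_iff' 1).2 ha.hasSum
      simpa [LSeries] using this
    have h3 := ((hL ha).mul_left ((c : ℂ) ^ (-s) * mellin φ s)).add
      ((hL hb).mul_left ((c : ℂ) ^ (-s) * mellin ψ s))
    simp_rw [h2] at h1
    have h4 := h1.unique h3
    rw [mellin]
    simp_rw [smul_eq_mul, ← tsum_mul_left, mul_add] at h4 ⊢
    rw [h4]
    ring
  · refine Summable.of_nonneg_of_le (fun n => integral_nonneg fun _ => norm_nonneg _) (fun n => ?_)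
      ((IsKernel.summable_integral_norm_dilate φ hc ha).add
        (IsKernel.summable_integral_norm_dilate ψ hc hb))
    have i1 := (hφ.integrableOn_dilate hc hs (a (n + 1)) n)
    have i2 := (hψ.integrableOn_dilate hc hs' (b (n + 1)) n)
    rw [← integral_add i1.norm i2.norm]
    exact integral_mono (i1.add i2).norm (i1.norm.add i2.norm) fun y => norm_add_le _ _

/-! ### The functional equation of a Mellin transform with four polar terms -/

/-- `y ↦ F(y) - a₀ - a₁ y^{1-k}`. -/
noncomputable def subConst (k : ℝ) (F : ℝ → ℂ) (a₀ a₁ : ℂ) (y : ℝ) : ℂ :=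
  F y - a₀ - a₁ * (y : ℂ) ^ (1 - (k : ℂ))

/-- Two continuous functions on `(0, ∞)` which approach `a₀ + a₁ y^{1-k}` and `b₀ + b₁ y^{1-k}`
exponentially fast at `∞` and are exchanged by `y ↦ 1/y` with the factor `ε y^k`. Mathlib's
`WeakFEPair` is not used since it requires `k > 0` and a single constant at `∞`. -/
structure IsFEPair (k : ℝ) (ε : ℂ) (F G : ℝ → ℂ) (a₀ a₁ b₀ b₁ : ℂ) : Prop where
  contF : ContinuousOn F (Set.Ioi 0)
  contG : ContinuousOn G (Set.Ioi 0)
  ne_zero : ε ≠ 0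
  map_inv : ∀ y : ℝ, 0 < y → F y⁻¹ = ε * (y : ℂ) ^ (k : ℂ) * G y
  decayF : ∃ c : ℝ, 0 < c ∧ subConst k F a₀ a₁ =O[atTop] fun y => Real.exp (-c * y)
  decayG : ∃ c : ℝ, 0 < c ∧ subConst k G b₀ b₁ =O[atTop] fun y => Real.exp (-c * y)

/-- `∫_1^∞ (F(y) - a₀ - a₁ y^{1-k}) y^{s-1} dy`, written as a Mellin transform over `(0, ∞)`. -/
noncomputable def tail (k : ℝ) (F : ℝ → ℂ) (a₀ a₁ : ℂ) (s : ℂ) : ℂ :=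
  mellin ((Set.Ioi 1).indicator (subConst k F a₀ a₁)) s

/-- The entire part of the continued Mellin transform. -/
noncomputable def entirePart (k : ℝ) (ε : ℂ) (F G : ℝ → ℂ) (a₀ a₁ b₀ b₁ : ℂ) (s : ℂ) : ℂ :=
  tail k F a₀ a₁ s + ε * tail k G b₀ b₁ (k - s)

/-- The meromorphic continuation of the Mellin transform of `F(y) - a₀ - a₁ y^{1-k}`. -/
noncomputable def continuation (k : ℝ) (ε : ℂ) (F G : ℝ → ℂ) (a₀ a₁ b₀ b₁ : ℂ) (s : ℂ) : ℂ :=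
  entirePart k ε F G a₀ a₁ b₀ b₁ s
    + (-a₀ / (s - 0) + ε * b₁ / (s - 1) + -a₁ / (s - (k - 1)) + ε * b₀ / (s - k))

lemma locallyIntegrableOn_indicator_subConst {k : ℝ} {F : ℝ → ℂ} {a₀ a₁ : ℂ}
    (hF : ContinuousOn F (Set.Ioi 0)) :
    LocallyIntegrableOn ((Set.Ioi 1).indicator (subConst k F a₀ a₁)) (Set.Ioi 0) := by
  have h : LocallyIntegrableOn (subConst k F a₀ a₁) (Set.Ioi 0) := by
    refine ContinuousOn.locallyIntegrableOn ?_ measurableSet_Ioi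
    refine (hF.sub continuousOn_const).sub (continuousOn_const.mul fun x hx => ?_)
    exact (continuousAt_ofReal_cpow_const x _ (Or.inr (ne_of_gt hx))).continuousWithinAt
  intro x hx
  obtain ⟨s, hs, hs'⟩ := h x hx
  exact ⟨s, hs, hs'.indicator measurableSet_Ioi⟩

lemma isBigO_zero_indicator_Ioi_one (f : ℝ → ℂ) (b : ℝ) :
    (Set.Ioi 1).indicator f =O[𝓝[>] 0] fun y : ℝ => y ^ (-b) := by
  refine IsBigO.of_bound 0 ?_
  filter_upwards [nhdsWithin_le_nhds (Iio_mem_nhds one_pos)] with y hy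
  have hy : y < 1 := hy
  simp [Set.indicator, hy.le]

lemma isBigO_atTop_indicator_Ioi_one {f : ℝ → ℂ} {c : ℝ} (hc : 0 < c)
    (hf : f =O[atTop] fun y => Real.exp (-c * y)) (a : ℝ) :
    (Set.Ioi 1).indicator f =O[atTop] fun y : ℝ => y ^ (-a) := by
  refine IsBigO.trans ?_ (hf.trans (isLittleO_exp_neg_mul_rpow_atTop hc (-a)).isBigO)
  refine IsBigO.of_bound 1 (Eventually.of_forall fun y => ?_)
  rw [one_mul]
  exact norm_indicator_le_norm_self _ _

section tail

variable {k : ℝ} {F : ℝ → ℂ} {a₀ a₁ : ℂ}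

lemma mellinConvergent_tail (hF : ContinuousOn F (Set.Ioi 0))
    (h : ∃ c : ℝ, 0 < c ∧ subConst k F a₀ a₁ =O[atTop] fun y => Real.exp (-c * y)) (s : ℂ) :
    MellinConvergent ((Set.Ioi 1).indicator (subConst k F a₀ a₁)) s := by
  obtain ⟨c, hc, hO⟩ := h
  exact mellinConvergent_of_isBigO_rpow (locallyIntegrableOn_indicator_subConst hF)
    (isBigO_atTop_indicator_Ioi_one hc hO (s.re + 1)) (by linarith)
    (isBigO_zero_indicator_Ioi_one _ (s.re - 1)) (by linarith)

lemma differentiable_tail (hF : ContinuousOn F (Set.Ioi 0))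
    (h : ∃ c : ℝ, 0 < c ∧ subConst k F a₀ a₁ =O[atTop] fun y => Real.exp (-c * y)) :
    Differentiable ℂ (tail k F a₀ a₁) := by
  obtain ⟨c, hc, hO⟩ := h
  intro s
  exact mellin_differentiableAt_of_isBigO_rpow (locallyIntegrableOn_indicator_subConst hF)
    (isBigO_atTop_indicator_Ioi_one hc hO (s.re + 1)) (by linarith)
    (isBigO_zero_indicator_Ioi_one _ (s.re - 1)) (by linarith)

end tail

lemma HasMellin.add' {f g : ℝ → ℂ} {s m n : ℂ} (hf : HasMellin f s m) (hg : HasMellin g s n) :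
    HasMellin (fun t => f t + g t) s (m + n) := by
  have := hasMellin_add hf.1 hg.1
  rwa [hf.2, hg.2] at this

lemma HasMellin.const_mul' {f : ℝ → ℂ} {s m : ℂ} (c : ℂ) (hf : HasMellin f s m) :
    HasMellin (fun t => c * f t) s (c * m) := by
  have := hasMellin_const_smul hf.1 c
  rwa [hf.2] at this

namespace IsFEPair

variable {k : ℝ} {ε : ℂ} {F G : ℝ → ℂ} {a₀ a₁ b₀ b₁ : ℂ}

lemma differentiable_entirePart (P : IsFEPair k ε F G a₀ a₁ b₀ b₁) :
    Differentiable ℂ (entirePart k ε F G a₀ a₁ b₀ b₁) := by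
  have h1 := differentiable_tail P.contF P.decayF
  have h2 := differentiable_tail P.contG P.decayG
  have h3 : Differentiable ℂ fun s : ℂ => tail k G b₀ b₁ (k - s) := h2.comp (by fun_prop)
  exact h1.add (h3.const_mul ε)

/-- The part of the integral over `(0, 1)` is turned into one over `(1, ∞)` by `y ↦ 1/y`; what is
left over are powers of `y` on `(0, 1]`, whose integrals are the polar terms. -/
lemma mellin_eq (P : IsFEPair k ε F G a₀ a₁ b₀ b₁) {s : ℂ} (h0 : 0 < s.re) (h1 : 1 < s.re)
    (hk : k < s.re) :
    mellin (subConst k F a₀ a₁) s = continuation k ε F G a₀ a₁ b₀ b₁ s := by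
  have m1 : HasMellin ((Set.Ioi 1).indicator (subConst k F a₀ a₁)) s (tail k F a₀ a₁ s) :=
    ⟨mellinConvergent_tail P.contF P.decayF s, rfl⟩
  have m2 : HasMellin (fun y : ℝ => (y : ℂ) ^ (-(k : ℂ)) •
      (Set.Ioi 1).indicator (subConst k G b₀ b₁) y⁻¹) s (tail k G b₀ b₁ (k - s)) := by
    constructor
    · rw [MellinConvergent.cpow_smul]
      have := (MellinConvergent.comp_rpow (f := (Set.Ioi 1).indicator (subConst k G b₀ b₁))
        (s := s + -(k : ℂ)) (a := -1) (by norm_num)).2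
        (mellinConvergent_tail P.contG P.decayG _)
      simpa only [Real.rpow_neg_one] using! this
    · rw [mellin_cpow_smul, mellin_comp_inv, tail]
      congr 1; ring
  have p0 : HasMellin ((Set.Ioc 0 1).indicator fun y : ℝ => (y : ℂ) ^ (0 : ℂ)) s (1 / (s + 0)) :=
    hasMellin_cpow_Ioc 0 (by simpa using h0)
  have p1 : HasMellin ((Set.Ioc 0 1).indicator fun y : ℝ => (y : ℂ) ^ (-1 : ℂ)) s
      (1 / (s + -1)) :=
    hasMellin_cpow_Ioc (-1) (by simpa using h1)
  have pk : HasMellin ((Set.Ioc 0 1).indicator fun y : ℝ => (y : ℂ) ^ (-(k : ℂ))) s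
      (1 / (s + -(k : ℂ))) :=
    hasMellin_cpow_Ioc (-(k : ℂ)) (by simpa using hk)
  have pk1 : HasMellin ((Set.Ioc 0 1).indicator fun y : ℝ => (y : ℂ) ^ (1 - (k : ℂ))) s
      (1 / (s + (1 - (k : ℂ)))) :=
    hasMellin_cpow_Ioc (1 - (k : ℂ)) (by simp; linarith)
  have key := (HasMellin.add' (HasMellin.add' m1 (HasMellin.const_mul' ε m2))
    (HasMellin.add' (HasMellin.add' (HasMellin.add' (HasMellin.const_mul' (-a₀) p0)
      (HasMellin.const_mul' (ε * b₁) p1)) (HasMellin.const_mul' (-a₁) pk1))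
      (HasMellin.const_mul' (ε * b₀) pk))).2
  refine Eq.trans (Eq.trans ?_ key) ?_
  · refine setIntegral_congr_ae measurableSet_Ioi ?_
    have hne : ∀ᵐ y : ℝ, y ≠ 1 := compl_mem_ae_iff.2 (measure_singleton 1)
    filter_upwards [hne] with y hy1 hy
    have hy : 0 < y := hy
    congr 1
    rcases lt_or_gt_of_ne hy1 with hlt | hgt
    · have hyi : 1 < y⁻¹ := (one_lt_inv₀ hy).2 hlt
      have hyc : (y : ℂ) ≠ 0 := by exact_mod_cast hy.ne'
      have hF : F y = ε * (y : ℂ) ^ (-(k : ℂ)) * G y⁻¹ := by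
        have := P.map_inv y⁻¹ (by positivity)
        rw [inv_inv] at this
        rw [this, ofReal_inv, inv_cpow _ _ (by rw [arg_ofReal_of_nonneg hy.le]; exact
          Real.pi_pos.ne), cpow_neg]
      have hpow : (y : ℂ) ^ (-(k : ℂ)) * ((y⁻¹ : ℝ) : ℂ) ^ (1 - (k : ℂ)) = (y : ℂ) ^ (-1 : ℂ) := by
        rw [ofReal_inv, inv_cpow _ _ (by rw [arg_ofReal_of_nonneg hy.le]; exact
          Real.pi_pos.ne), ← cpow_neg, ← cpow_add _ _ hyc]
        congr 1; ring
      have n1 : y ∉ Set.Ioi (1 : ℝ) := not_lt.2 hlt.le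
      have n2 : y⁻¹ ∈ Set.Ioi (1 : ℝ) := hyi
      have n3 : y ∈ Set.Ioc (0 : ℝ) 1 := ⟨hy, hlt.le⟩
      rw [Set.indicator_of_notMem n1, Set.indicator_of_mem n2, Set.indicator_of_mem n3,
        Set.indicator_of_mem n3, Set.indicator_of_mem n3, Set.indicator_of_mem n3]
      simp only [subConst, cpow_zero, smul_eq_mul]
      rw [hF, ← hpow]
      ring
    · have n1 : y ∈ Set.Ioi (1 : ℝ) := hgt
      have n2 : y⁻¹ ∉ Set.Ioi (1 : ℝ) := not_lt.2 (inv_le_one_of_one_le₀ hgt.le)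
      have n3 : y ∉ Set.Ioc (0 : ℝ) 1 := fun h => not_lt.2 h.2 hgt
      rw [Set.indicator_of_mem n1, Set.indicator_of_notMem n2, Set.indicator_of_notMem n3,
        Set.indicator_of_notMem n3, Set.indicator_of_notMem n3, Set.indicator_of_notMem n3]
      simp
  · rw [continuation, entirePart]
    congr 1
    rw [show s + (1 - (k : ℂ)) = s - (k - 1) by ring, add_zero, sub_zero]
    simp only [← sub_eq_add_neg]
    ring

lemma continuation_eq (hε : ε ≠ 0) (s : ℂ) :
    continuation k ε F G a₀ a₁ b₀ b₁ s
      = ε * continuation k ε⁻¹ G F b₀ b₁ a₀ a₁ (k - s) := by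
  have e : ∀ x y z : ℂ, x / (-(y - z)) = - (x / (y - z)) := fun x y z => by rw [div_neg]
  simp only [continuation, entirePart]
  rw [show (k : ℂ) - (k - s) = s by ring, show (k : ℂ) - s - 0 = -(s - k) by ring,
    show (k : ℂ) - s - 1 = -(s - (k - 1)) by ring, show (k : ℂ) - s - (k - 1) = -(s - 1) by ring,
    show (k : ℂ) - s - k = -(s - 0) by ring]
  simp only [e, mul_add]
  have h (x : ℂ) : ε * (ε⁻¹ * x) = x := by rw [← mul_assoc, mul_inv_cancel₀ hε, one_mul]
  have h' (x y z : ℂ) : ε * -(ε⁻¹ * x / (y - z)) = -x / (y - z) := by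
    rw [mul_div_assoc, mul_neg, h, neg_div]
  simp only [h, h']
  ring

lemma analyticAt_continuation (P : IsFEPair k ε F G a₀ a₁ b₀ b₁) {s : ℂ}
    (hs : s ∉ ({0, 1, (k : ℂ) - 1, (k : ℂ)} : Set ℂ)) :
    AnalyticAt ℂ (continuation k ε F G a₀ a₁ b₀ b₁) s := by
  simp only [Set.mem_insert_iff, Set.mem_singleton_iff, not_or] at hs
  have h (c : ℂ) {p : ℂ} (hp : s ≠ p) : AnalyticAt ℂ (fun s => c / (s - p)) s :=
    analyticAt_const.div (analyticAt_id.sub analyticAt_const) (sub_ne_zero.2 hp)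
  exact (P.differentiable_entirePart.analyticAt s).add
    ((((h _ hs.1).add (h _ hs.2.1)).add (h _ hs.2.2.1)).add (h _ hs.2.2.2))

lemma meromorphicAt_continuation (P : IsFEPair k ε F G a₀ a₁ b₀ b₁) (s : ℂ) :
    MeromorphicAt (continuation k ε F G a₀ a₁ b₀ b₁) s := by
  have h (c p : ℂ) : MeromorphicAt (fun s => c / (s - p)) s :=
    (MeromorphicAt.const c s).div ((MeromorphicAt.id s).sub (MeromorphicAt.const p s))
  exact (P.differentiable_entirePart.analyticAt s).meromorphicAt.add
    ((((h _ _).add (h _ _)).add (h _ _)).add (h _ _))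

end IsFEPair

open Classical in
lemma tendsto_sub_mul_div_sub (c p q : ℂ) :
    Tendsto (fun s : ℂ => (s - p) * (c / (s - q))) (𝓝[≠] p) (𝓝 (if p = q then c else 0)) := by
  split_ifs with h
  · subst h
    refine tendsto_const_nhds.congr' ?_
    filter_upwards [self_mem_nhdsWithin] with s hs
    have : s - p ≠ 0 := sub_ne_zero.2 hs
    field_simp
  · have : ContinuousAt (fun s : ℂ => (s - p) * (c / (s - q))) p := by
      refine ContinuousAt.mul (by fun_prop) (ContinuousAt.div (by fun_prop) (by fun_prop) ?_)
      exact sub_ne_zero.2 h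
    simpa using this.tendsto.mono_left nhdsWithin_le_nhds

open Classical in
lemma IsFEPair.tendsto_residue {k : ℝ} {ε : ℂ} {F G : ℝ → ℂ} {a₀ a₁ b₀ b₁ : ℂ}
    (P : IsFEPair k ε F G a₀ a₁ b₀ b₁) (p : ℂ) :
    Tendsto (fun s => (s - p) * continuation k ε F G a₀ a₁ b₀ b₁ s) (𝓝[≠] p)
      (𝓝 ((if p = 0 then -a₀ else 0) + (if p = 1 then ε * b₁ else 0)
        + (if p = (k : ℂ) - 1 then -a₁ else 0) + (if p = (k : ℂ) then ε * b₀ else 0))) := by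
  have h1 : ContinuousAt (fun s => (s - p) * entirePart k ε F G a₀ a₁ b₀ b₁ s) p :=
    ContinuousAt.mul (by fun_prop) P.differentiable_entirePart.continuous.continuousAt
  have h2 := h1.tendsto.mono_left (nhdsWithin_le_nhds (s := {p}ᶜ))
  rw [sub_self, zero_mul] at h2
  have h3 := h2.add ((((tendsto_sub_mul_div_sub (-a₀) p 0).add
    (tendsto_sub_mul_div_sub (ε * b₁) p 1)).add
    (tendsto_sub_mul_div_sub (-a₁) p ((k : ℂ) - 1))).add
    (tendsto_sub_mul_div_sub (ε * b₀) p k))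
  rw [zero_add] at h3
  refine h3.congr fun s => ?_
  simp only [continuation]
  ring

/-- Identity theorem on a half-plane, across the possible poles: both sides are multiplied by
`s (s - 1) (s - (k - 1)) (s - k)` first. -/
lemma IsFEPair.eq_continuation_of_eq {k : ℝ} {ε : ℂ} {F G : ℝ → ℂ} {a₀ a₁ b₀ b₁ : ℂ}
    (P : IsFEPair k ε F G a₀ a₁ b₀ b₁) {D : ℂ → ℂ} {σ σ' : ℝ}
    (hD : DifferentiableOn ℂ D {s | σ < s.re})
    (hDσ' : ∀ s : ℂ, σ' < s.re → D s = continuation k ε F G a₀ a₁ b₀ b₁ s)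
    {s : ℂ} (hs : σ < s.re) (hs' : s ∉ ({0, 1, (k : ℂ) - 1, (k : ℂ)} : Set ℂ)) :
    D s = continuation k ε F G a₀ a₁ b₀ b₁ s := by
  set E := entirePart k ε F G a₀ a₁ b₀ b₁ with hE
  have hEd : Differentiable ℂ E := P.differentiable_entirePart
  set Q : ℂ → ℂ := fun s => (s - 0) * (s - 1) * (s - (k - 1)) * (s - k) with hQ
  set H : ℂ → ℂ := fun s => Q s * E s + (-a₀ * ((s - 1) * (s - (k - 1)) * (s - k))
    + ε * b₁ * ((s - 0) * (s - (k - 1)) * (s - k)) + -a₁ * ((s - 0) * (s - 1) * (s - k))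
    + ε * b₀ * ((s - 0) * (s - 1) * (s - (k - 1)))) with hH
  have hHQ : ∀ s : ℂ, s ∉ ({0, 1, (k : ℂ) - 1, (k : ℂ)} : Set ℂ) →
      Q s ≠ 0 ∧ H s = Q s * continuation k ε F G a₀ a₁ b₀ b₁ s := by
    intro s hs
    simp only [Set.mem_insert_iff, Set.mem_singleton_iff, not_or] at hs
    have h0 : s - 0 ≠ 0 := sub_ne_zero.2 hs.1
    have h1 : s - 1 ≠ 0 := sub_ne_zero.2 hs.2.1
    have h2 : s - ((k : ℂ) - 1) ≠ 0 := sub_ne_zero.2 hs.2.2.1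
    have h3 : s - (k : ℂ) ≠ 0 := sub_ne_zero.2 hs.2.2.2
    refine ⟨by simp only [hQ]; positivity, ?_⟩
    simp only [hH, hQ, continuation, ← hE]
    generalize s - 0 = u0 at *
    generalize s - 1 = u1 at *
    generalize s - ((k : ℂ) - 1) = u2 at *
    generalize s - (k : ℂ) = u3 at *
    field_simp
  have hHd : Differentiable ℂ H := by fun_prop
  have hQd : Differentiable ℂ Q := by fun_prop
  have hopen : IsOpen {s : ℂ | σ < s.re} := isOpen_lt continuous_const continuous_re
  have hconv : IsPreconnected {s : ℂ | σ < s.re} := (convex_halfSpace_re_gt σ).isPreconnected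
  have hQD : AnalyticOnNhd ℂ (fun s => Q s * D s) {s : ℂ | σ < s.re} :=
    (hQd.differentiableOn.mul hD).analyticOnNhd hopen
  have hHa : AnalyticOnNhd ℂ H {s : ℂ | σ < s.re} := hHd.differentiableOn.analyticOnNhd hopen
  set r : ℝ := max (max σ σ') (max 1 k) + 1 with hr
  have hr0 : max (max σ σ') (max 1 k) < r := by linarith
  simp only [max_lt_iff] at hr0
  have hev : (fun s => Q s * D s) =ᶠ[𝓝 (r : ℂ)] H := by
    have hU : {s : ℂ | max (max σ σ') (max 1 k) < s.re} ∈ 𝓝 (r : ℂ) :=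
      (isOpen_lt continuous_const continuous_re).mem_nhds (by simp [hr0])
    filter_upwards [hU] with z hz
    simp only [max_lt_iff] at hz
    have hz' : z ∉ ({0, 1, (k : ℂ) - 1, (k : ℂ)} : Set ℂ) := by
      simp only [Set.mem_insert_iff, Set.mem_singleton_iff, not_or]
      refine ⟨?_, ?_, ?_, ?_⟩ <;> rintro rfl <;> simp at hz <;> linarith
    rw [(hHQ z hz').2, hDσ' z hz.1.2]
  have := hQD.eqOn_of_preconnected_of_eventuallyEq hHa hconv
    (z₀ := (r : ℂ)) (by simp [hr0]) hev hs
  simp only at this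
  rw [(hHQ s hs').2] at this
  exact mul_left_cancel₀ (hHQ s hs').1 this

/-! ### Principal powers -/

lemma mul_cpow_of_arg_add_mem {x y : ℂ} (hx : x ≠ 0) (hy : y ≠ 0)
    (h : x.arg + y.arg ∈ Set.Ioc (-Real.pi) Real.pi) (s : ℂ) :
    (x * y) ^ s = x ^ s * y ^ s := by
  rw [cpow_def_of_ne_zero (mul_ne_zero hx hy), cpow_def_of_ne_zero hx, cpow_def_of_ne_zero hy,
    (log_mul_eq_add_log_iff hx hy).2 h, add_mul, Complex.exp_add]

lemma ofReal_mul_cpow {r : ℝ} (hr : 0 < r) {z : ℂ} (hz : z ≠ 0) (s : ℂ) :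
    ((r : ℂ) * z) ^ s = (r : ℂ) ^ s * z ^ s := by
  refine mul_cpow_of_arg_add_mem (ofReal_ne_zero.2 hr.ne') hz ?_ s
  rw [arg_ofReal_of_nonneg hr.le, zero_add]
  exact arg_mem_Ioc z

/-! ### From Fourier expansions to the completed `L`-function -/

lemma PolyBound.summable_norm_mul_exp {a : ℕ → ℂ} {μ : ℝ} (ha : PolyBound a μ) {δ : ℝ}
    (hδ : 0 < δ) : Summable fun n : ℕ => ‖a (n + 1)‖ * Real.exp (-δ * (n + 1 : ℕ)) := by
  have h1 : (fun n : ℕ => ‖a n‖ * Real.exp (-δ * n)) =O[atTop]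
      fun n : ℕ => (n : ℝ) ^ (-2 : ℝ) := by
    have h2 : (fun n : ℕ => Real.exp (-δ * n)) =O[atTop] fun n : ℕ => (n : ℝ) ^ (-2 - μ) :=
      (isLittleO_exp_neg_mul_rpow_atTop hδ (-2 - μ)).isBigO.comp_tendsto
        tendsto_natCast_atTop_atTop
    refine (ha.norm_left.mul h2).congr' EventuallyEq.rfl ?_
    filter_upwards [eventually_gt_atTop 0] with n hn
    rw [← Real.rpow_add (by exact_mod_cast hn)]
    congr 1; ring
  have h3 := summable_of_isBigO_nat (Real.summable_nat_rpow.2 (by norm_num)) h1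
  exact (summable_nat_add_iff 1).2 h3

section dilates

variable {σ : ℝ} {φ : ℝ → ℂ} {a : ℕ → ℂ} {μ c : ℝ}

lemma IsKernel.summable_dilates (h : IsKernel σ φ) (hσ : 0 ≤ σ) (ha : PolyBound a μ)
    (hc : 0 < c) {y : ℝ} (hy : 0 < y) :
    Summable fun n : ℕ => a (n + 1) * φ (c * (n + 1 : ℕ) * y) := by
  obtain ⟨C, δ, _, hδ, hb⟩ := h.exists_norm_dilate_le hσ hc hy
  refine Summable.of_norm_bounded
    ((ha.summable_norm_mul_exp hδ).mul_left (C * Real.exp (-(c / 4) * y))) fun n => ?_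
  rw [norm_mul]
  calc ‖a (n + 1)‖ * ‖φ (c * (n + 1 : ℕ) * y)‖
      ≤ ‖a (n + 1)‖ * (C * (Real.exp (-δ * (n + 1 : ℕ)) * Real.exp (-(c / 4) * y))) := by
        gcongr
        exact hb n y le_rfl
    _ = _ := by ring

lemma IsKernel.isBigO_tsum_dilates (h : IsKernel σ φ) (hσ : 0 ≤ σ) (ha : PolyBound a μ)
    (hc : 0 < c) :
    (fun y : ℝ => ∑' n : ℕ, a (n + 1) * φ (c * (n + 1 : ℕ) * y)) =O[atTop]
      fun y => Real.exp (-(c / 4) * y) := by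
  obtain ⟨C, δ, _, hδ, hb⟩ := h.exists_norm_dilate_le hσ hc one_pos
  refine IsBigO.of_bound (C * ∑' n : ℕ, ‖a (n + 1)‖ * Real.exp (-δ * (n + 1 : ℕ))) ?_
  filter_upwards [eventually_ge_atTop 1] with y hy
  rw [Real.norm_of_nonneg (Real.exp_pos _).le, mul_right_comm]
  refine tsum_of_norm_bounded ((ha.summable_norm_mul_exp hδ).hasSum.mul_left
    (C * Real.exp (-(c / 4) * y))) fun n => ?_
  rw [norm_mul]
  calc ‖a (n + 1)‖ * ‖φ (c * (n + 1 : ℕ) * y)‖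
      ≤ ‖a (n + 1)‖ * (C * (Real.exp (-δ * (n + 1 : ℕ)) * Real.exp (-(c / 4) * y))) := by
        gcongr
        exact hb n y hy
    _ = _ := by ring

end dilates

/-- `φ⁺(x) = e^{-x}`, with Mellin transform `Γ(s)`. -/
noncomputable def kernelPlus (x : ℝ) : ℂ := (Real.exp (-x) : ℂ)

/-- `φ⁻(x) = Γ(1-k, 2x) e^x`, with Mellin transform `W_{1-k}(s)`. -/
noncomputable def kernelMinus (k x : ℝ) : ℂ := ((incGamma (1 - k) (2 * x) * Real.exp x : ℝ) : ℂ)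

lemma isKernel_kernelPlus : IsKernel 0 kernelPlus := isKernel_exp

/-- At `0` the function `Γ(1-k, 2x)` is bounded if `k < 1`, of logarithmic size if `k = 1`, and of
size `x^{1-k}` if `k > 1`. The exponent `σ = max 0 k` always qualifies. -/
lemma isKernel_kernelMinus {k σ : ℝ} (hσ : 0 ≤ σ) (hk : k - 1 < σ) :
    IsKernel σ (kernelMinus k) :=
  isKernel_incGamma (1 - k) σ hσ (by linarith)

/-- `y ↦ f(iy/√N)`, for `y > 0`; the values at `y ≤ 0` are never used. -/
noncomputable def axis (N : ℕ) (f : ℍ → ℂ) (y : ℝ) : ℂ :=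
  f (UpperHalfPlane.ofComplex (((y / √N : ℝ) : ℂ) * I))

lemma tsum_expansion_axis {k : ℝ} {N : ℕ} (hN : 0 < N) {f : ℍ → ℂ} {ap am : ℕ → ℂ} {μp μm : ℝ}
    (hf : HasExpansion k f ap am) (hp : PolyBound ap μp) (hm : PolyBound am μm)
    {y : ℝ} (hy : 0 < y) :
    subConst k (axis N f) (ap 0) (am 0 * (N : ℂ) ^ (((k : ℂ) - 1) / 2)) y
      = ∑' n : ℕ, (ap (n + 1) * kernelPlus (2 * Real.pi / √N * (n + 1 : ℕ) * y)
        + am (n + 1) * kernelMinus k (2 * Real.pi / √N * (n + 1 : ℕ) * y)) := by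
  have hsN : 0 < √(N : ℝ) := Real.sqrt_pos.2 (by exact_mod_cast hN)
  have hc : 0 < 2 * Real.pi / √(N : ℝ) := by positivity
  have him : 0 < ((((y / √N : ℝ) : ℂ)) * I).im := by simp; positivity
  set τ : ℍ := ⟨((y / √N : ℝ) : ℂ) * I, him⟩ with hτ
  have hax : axis N f y = f τ := by rw [axis, UpperHalfPlane.ofComplex_apply_of_im_pos him]
  have hτim : τ.im = y / √N := by simp [hτ]
  have hq : ∀ n : ℤ, qpow n τ = (Real.exp (-(2 * Real.pi / √N * n * y)) : ℂ) := by
    intro n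
    rw [qpow, ofReal_exp]
    congr 1
    simp only [hτ]
    push_cast
    linear_combination (2 * Real.pi * n * (y / √N) : ℂ) * I_mul_I
  have hplus : ∀ n : ℕ, ap (n + 1) * qpow (n + 1 : ℕ) τ
      = ap (n + 1) * kernelPlus (2 * Real.pi / √N * (n + 1 : ℕ) * y) := by
    intro n; rw [hq]; simp [kernelPlus]
  have hminus : ∀ n : ℕ, minusTerm k am (n + 1) τ
      = am (n + 1) * kernelMinus k (2 * Real.pi / √N * (n + 1 : ℕ) * y) := by
    intro n
    rw [minusTerm, hq, kernelMinus, hτim, mul_assoc, ← ofReal_mul]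
    congr 4
    · ring
    · push_cast; ring
  have h0 : qpow (0 : ℕ) τ = 1 := by simp [qpow]
  have hpow : ((τ.im ^ (1 - k) : ℝ) : ℂ)
      = (N : ℂ) ^ (((k : ℂ) - 1) / 2) * (y : ℂ) ^ (1 - (k : ℂ)) := by
    have e1 : (N : ℂ) ^ (((k : ℂ) - 1) / 2) = (((N : ℝ) ^ ((k - 1) / 2) : ℝ) : ℂ) := by
      rw [ofReal_cpow (by positivity)]; push_cast; rfl
    have e2 : (y : ℂ) ^ (1 - (k : ℂ)) = ((y ^ (1 - k) : ℝ) : ℂ) := by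
      rw [ofReal_cpow hy.le]; push_cast; rfl
    rw [e1, e2, ← ofReal_mul, hτim, Real.div_rpow hy.le hsN.le, Real.sqrt_eq_rpow,
      ← Real.rpow_mul (by positivity), div_eq_mul_inv, ← Real.rpow_neg (by positivity), mul_comm]
    congr 3; ring
  have s1 := isKernel_kernelPlus.summable_dilates le_rfl hp hc hy
  have s2 := (isKernel_kernelMinus (le_max_left 0 k)
    (lt_max_of_lt_right (by linarith : k - 1 < k))).summable_dilates (le_max_left 0 k) hm hc hy
  rw [s1.tsum_add s2, subConst, hax, hf.eq τ, (hf.summable_plus τ).tsum_eq_zero_add, h0, hpow]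
  simp_rw [hplus, hminus]
  ring

lemma isBigO_subConst_axis {k : ℝ} {N : ℕ} (hN : 0 < N) {f : ℍ → ℂ} {ap am : ℕ → ℂ} {μp μm : ℝ}
    (hf : HasExpansion k f ap am) (hp : PolyBound ap μp) (hm : PolyBound am μm) :
    ∃ c : ℝ, 0 < c ∧ subConst k (axis N f) (ap 0) (am 0 * (N : ℂ) ^ (((k : ℂ) - 1) / 2))
      =O[atTop] fun y => Real.exp (-c * y) := by
  have hsN : 0 < √(N : ℝ) := Real.sqrt_pos.2 (by exact_mod_cast hN)
  have hc : 0 < 2 * Real.pi / √(N : ℝ) := by positivity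
  have hK := isKernel_kernelMinus (le_max_left 0 k)
    (lt_max_of_lt_right (by linarith : k - 1 < k))
  refine ⟨2 * Real.pi / √(N : ℝ) / 4, by positivity, ?_⟩
  refine ((isKernel_kernelPlus.isBigO_tsum_dilates le_rfl hp hc).add
    (hK.isBigO_tsum_dilates (le_max_left 0 k) hm hc)).congr' ?_ EventuallyEq.rfl
  filter_upwards [eventually_gt_atTop 0] with y hy
  rw [tsum_expansion_axis hN hf hp hm hy, Summable.tsum_add
    (isKernel_kernelPlus.summable_dilates le_rfl hp hc hy)
    (hK.summable_dilates (le_max_left 0 k) hm hc hy)]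

lemma completedL_eq {N : ℕ} (hN : 0 < N) {k : ℝ} {ap am : ℕ → ℂ} {s : ℂ} (hs : 0 < s.re) :
    completedL N k ap am s = ((2 * Real.pi / √N : ℝ) : ℂ) ^ (-s)
      * (mellin kernelPlus s * LSeries ap s + mellin (kernelMinus k) s * LSeries am s) := by
  have hsN : 0 < √(N : ℝ) := Real.sqrt_pos.2 (by exact_mod_cast hN)
  have h1 : Complex.Gamma s = mellin kernelPlus s := by
    rw [Gamma_eq_integral hs, GammaIntegral_eq_mellin]; rfl
  have h2 : W (1 - k) s = mellin (kernelMinus k) s := by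
    simp only [W, mellin, kernelMinus, smul_eq_mul, mul_comm]
  have h3 : ((√N / (2 * Real.pi) : ℝ) : ℂ) ^ s = ((2 * Real.pi / √N : ℝ) : ℂ) ^ (-s) := by
    rw [← inv_div, ofReal_inv, inv_cpow, cpow_neg]
    rw [arg_ofReal_of_nonneg (by positivity)]
    exact Real.pi_pos.ne
  rw [completedL, h1, h2, h3]

lemma differentiableOn_completedL {N : ℕ} (hN : 0 < N) {k : ℝ} {ap am : ℕ → ℂ} {μp μm : ℝ}
    (hp : PolyBound ap μp) (hm : PolyBound am μm) :
    DifferentiableOn ℂ (completedL N k ap am)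
      {s | max (max (μp + 1) (μm + 1)) (max (k - 1) 0) < s.re} := by
  have hsN : 0 < √(N : ℝ) := Real.sqrt_pos.2 (by exact_mod_cast hN)
  have hL : ∀ {a : ℕ → ℂ} {μ : ℝ} {s : ℂ}, PolyBound a μ → μ + 1 < s.re →
      DifferentiableAt ℂ (LSeries a) s := fun ha hs =>
    (LSeries_analyticOnNhd _ _ ((LSeries.abscissaOfAbsConv_le_of_isBigO_rpow ha).trans_lt
      (by exact_mod_cast hs))).differentiableAt
  have key : DifferentiableOn ℂ (fun s : ℂ => ((2 * Real.pi / √N : ℝ) : ℂ) ^ (-s)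
      * (mellin kernelPlus s * LSeries ap s + mellin (kernelMinus k) s * LSeries am s))
      {s | max (max (μp + 1) (μm + 1)) (max (k - 1) 0) < s.re} := by
    intro s hs
    simp only [Set.mem_ofPred_eq, max_lt_iff] at hs
    obtain ⟨⟨h1, h2⟩, h3, h4⟩ := hs
    obtain ⟨σ, hσ, hσs⟩ := exists_between (max_lt h3 h4)
    rw [max_lt_iff] at hσ
    have d1 := isKernel_kernelPlus.differentiableAt_mellin h4
    have d2 := (isKernel_kernelMinus hσ.2.le hσ.1).differentiableAt_mellin hσs
    have d3 : DifferentiableAt ℂ (fun s : ℂ => ((2 * Real.pi / √N : ℝ) : ℂ) ^ (-s)) s := by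
      refine DifferentiableAt.const_cpow (by fun_prop) (Or.inl ?_)
      exact ofReal_ne_zero.2 (by positivity)
    exact (d3.mul ((d1.mul (hL hp h1)).add (d2.mul (hL hm h2)))).differentiableWithinAt
  refine key.congr fun s hs => completedL_eq hN ?_
  simp only [Set.mem_ofPred_eq, max_lt_iff] at hs
  exact hs.2.2

lemma mellin_subConst_axis {k : ℝ} {N : ℕ} (hN : 0 < N) {f : ℍ → ℂ} {ap am : ℕ → ℂ} {μp μm : ℝ}
    (hf : HasExpansion k f ap am) (hp : PolyBound ap μp) (hm : PolyBound am μm) {s : ℂ}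
    (hs : max (max (μp + 1) (μm + 1)) (max (k - 1) 0) < s.re) :
    mellin (subConst k (axis N f) (ap 0) (am 0 * (N : ℂ) ^ (((k : ℂ) - 1) / 2))) s
      = completedL N k ap am s := by
  have hsN : 0 < √(N : ℝ) := Real.sqrt_pos.2 (by exact_mod_cast hN)
  simp only [max_lt_iff] at hs
  obtain ⟨⟨h1, h2⟩, h3, h4⟩ := hs
  obtain ⟨σ, hσ, hσs⟩ := exists_between (max_lt h3 h4)
  rw [max_lt_iff] at hσ
  have hL : ∀ {a : ℕ → ℂ} {μ : ℝ}, PolyBound a μ → μ + 1 < s.re → LSeriesSummable a s :=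
    fun ha hs => LSeriesSummable_of_isBigO_rpow hs (by simpa using! ha)
  rw [completedL_eq hN h4, ← mellin_dirichlet isKernel_kernelPlus
    (isKernel_kernelMinus hσ.2.le hσ.1) (by positivity) h4 hσs (hL hp h1) (hL hm h2)]
  refine setIntegral_congr_fun measurableSet_Ioi fun y hy => ?_
  simp only
  rw [tsum_expansion_axis hN hf hp hm hy]

lemma axis_inv {k : ℝ} {N : ℕ} (hN : 0 < N) (f : ℍ → ℂ) {y : ℝ} (hy : 0 < y) :
    axis N f y⁻¹ = I ^ (k : ℂ) * (y : ℂ) ^ (k : ℂ) * axis N (fricke k N f) y := by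
  have hsN : 0 < √(N : ℝ) := Real.sqrt_pos.2 (by exact_mod_cast hN)
  have hss : √(N : ℝ) * √(N : ℝ) = N := Real.mul_self_sqrt (by positivity)
  have him : 0 < ((((y / √N : ℝ) : ℂ)) * I).im := by simp; positivity
  have e1 : (N : ℂ) * (((y / √N : ℝ) : ℂ) * I) = ((√N * y : ℝ) : ℂ) * I := by
    rw [← mul_assoc, ← ofReal_natCast, ← ofReal_mul]
    congr 2
    nth_rewrite 1 [← hss]
    field_simp
  have e2 : -1 / (((√N * y : ℝ) : ℂ) * I) = ((y⁻¹ / √N : ℝ) : ℂ) * I := by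
    have : (√N : ℂ) ≠ 0 := ofReal_ne_zero.2 hsN.ne'
    have : (y : ℂ) ≠ 0 := ofReal_ne_zero.2 hy.ne'
    push_cast
    field_simp
    simp
  have e3 : (N : ℂ) ^ ((k : ℂ) / 2) = ((√N : ℝ) : ℂ) ^ (k : ℂ) := by
    have h1 : (N : ℂ) ^ ((k : ℂ) / 2) = (((N : ℝ) ^ (k / 2) : ℝ) : ℂ) := by
      rw [ofReal_cpow (by positivity)]; push_cast; rfl
    rw [h1, ← ofReal_cpow hsN.le, Real.sqrt_eq_rpow, ← Real.rpow_mul (by positivity)]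
    congr 2; ring
  have hI : I ^ (k : ℂ) ≠ 0 := by simp [cpow_eq_zero_iff]
  have hy' : (y : ℂ) ^ (k : ℂ) ≠ 0 := by simp [cpow_eq_zero_iff, hy.ne']
  have hs' : ((√N : ℝ) : ℂ) ^ (k : ℂ) ≠ 0 := by
    simp only [ne_eq, cpow_eq_zero_iff, ofReal_eq_zero, hsN.ne', false_and, not_false_eq_true]
  simp only [axis, fricke]
  rw [UpperHalfPlane.ofComplex_apply_of_im_pos him]
  simp only
  rw [e1, e2, e3, ofReal_mul_cpow (by positivity) I_ne_zero, ofReal_mul,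
    mul_cpow_ofReal_nonneg hsN.le hy.le, cpow_neg, cpow_neg, cpow_neg]
  field_simp

/-! ### Growth near the real axis -/

/-- `y^{k/2} |f(τ)|`, which is invariant under `Γ₀(N)` for a form of weight `k`. -/
noncomputable def invNorm (k : ℝ) (f : ℍ → ℂ) (τ : ℍ) : ℝ := τ.im ^ (k / 2) * ‖f τ‖

/-- Polynomial growth of `y^{k/2} |f|` in `y` and `1/y`, on a strip of width one. -/
def ModerateGrowth (k : ℝ) (f : ℍ → ℂ) : Prop :=
  ∃ C t : ℝ, 0 ≤ C ∧ 0 ≤ t ∧ ∀ τ : ℍ, 0 ≤ τ.re → τ.re ≤ 1 →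
    invNorm k f τ ≤ C * max τ.im (1 / τ.im) ^ t

/-- No parity of `d` is required, since the Jacobi symbol is defined for all natural moduli. -/
lemma norm_kroneckerOdd {c d : ℤ} (h : IsCoprime c d) : ‖(kroneckerOdd c d : ℂ)‖ = 1 := by
  have hg : c.gcd (d.natAbs : ℤ) = 1 := by
    simpa [Int.gcd, Int.natAbs_abs] using Int.isCoprime_iff_gcd_eq_one.1 h
  rw [kroneckerOdd]
  rcases jacobiSym.eq_one_or_neg_one hg with h1 | h1 <;> rw [h1] <;> split_ifs <;> simp

lemma norm_slashFactor (m : ℤ) {c d : ℤ} (h : IsCoprime c d) : ‖slashFactor m c d‖ = 1 := by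
  rw [slashFactor]
  split_ifs
  · simp
  · rw [norm_mul, norm_kroneckerOdd h, epsilonOdd]
    split_ifs <;> simp

lemma invNorm_smul (k : ℝ) (f : ℍ → ℂ) (γ : SL(2, ℤ)) (τ : ℍ) :
    invNorm k f (γ • τ) = τ.im ^ (k / 2) * ‖plainSlash k f γ τ‖ := by
  have hden : ((γ 1 0 : ℤ) : ℂ) * (τ : ℂ) + ((γ 1 1 : ℤ) : ℂ)
      = UpperHalfPlane.denom (γ : GL (Fin 2) ℝ) τ := by
    rw [ModularGroup.denom_apply]
  have h0 : UpperHalfPlane.denom (γ : GL (Fin 2) ℝ) τ ≠ 0 := UpperHalfPlane.denom_ne_zero _ τ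
  have hn : 0 < ‖UpperHalfPlane.denom (γ : GL (Fin 2) ℝ) τ‖ := norm_pos_iff.2 h0
  rw [invNorm, plainSlash, hden, norm_mul, ModularGroup.im_smul_eq_div_normSq,
    Complex.normSq_eq_norm_sq, Real.div_rpow τ.im_pos.le (by positivity), ← ofReal_neg,
    norm_cpow_real, Real.rpow_neg hn.le, ← Real.rpow_natCast, ← Real.rpow_mul hn.le]
  rw [show ((2 : ℕ) : ℝ) * (k / 2) = k by push_cast; ring]
  ring

section form

variable {m : ℤ} {N : ℕ} {χ : CongruenceSubgroup.Gamma0 N →* Circle} {f : ℍ → ℂ}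

lemma isCoprime_bottom_row (γ : SL(2, ℤ)) : IsCoprime (γ 1 0) (γ 1 1) := by
  have := γ.det_coe
  rw [Matrix.det_fin_two] at this
  exact ⟨-(γ 0 1), γ 0 0, by linarith⟩

lemma IsHarmonicMaassForm.invNorm_smul_eq (hf : IsHarmonicMaassForm m N χ f)
    (γ : CongruenceSubgroup.Gamma0 N) (τ : ℍ) :
    invNorm ((m : ℝ) / 2) f ((γ : SL(2, ℤ)) • τ) = invNorm ((m : ℝ) / 2) f τ := by
  have h := congrArg norm (hf.transform γ τ)
  rw [slash, norm_mul, norm_slashFactor m (isCoprime_bottom_row _), one_mul, norm_mul,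
    Circle.norm_coe, one_mul] at h
  rw [invNorm_smul, h, invNorm]

lemma IsHarmonicMaassForm.continuous (hf : IsHarmonicMaassForm m N χ f) : Continuous f := by
  have h := hf.smooth.continuousOn.comp_continuous UpperHalfPlane.continuous_coe
    fun τ : ℍ => τ.im_pos
  simpa [Function.comp_def] using! h

lemma continuous_invNorm {k : ℝ} (hf : Continuous f) : Continuous (invNorm k f) := by
  have : Continuous fun τ : ℍ => τ.im ^ (k / 2) :=
    UpperHalfPlane.continuous_im.rpow_const fun τ => Or.inl τ.im_ne_zero
  exact this.mul hf.norm

/-- A `Γ₀(N)`-invariant continuous function of polynomial growth at all cusps is bounded by a power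
of `max(y, 1/y)` on the whole upper half-plane. -/
lemma IsHarmonicMaassForm.exists_invNorm_le (hN : 0 < N) (hf : IsHarmonicMaassForm m N χ f) :
    ∃ C t : ℝ, 0 ≤ t ∧ ∀ τ : ℍ, invNorm ((m : ℝ) / 2) f τ ≤ C * max τ.im (1 / τ.im) ^ t := by
  set k : ℝ := (m : ℝ) / 2 with hk
  have : NeZero N := ⟨hN.ne'⟩
  have : (CongruenceSubgroup.Gamma0 N).FiniteIndex := inferInstance
  have : Fintype (SL(2, ℤ) ⧸ CongruenceSubgroup.Gamma0 N) :=
    Subgroup.fintypeQuotientOfFiniteIndex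
  choose A hA using hf.growth
  obtain ⟨B, hB⟩ : ∃ B : ℝ, ∀ q : SL(2, ℤ) ⧸ CongruenceSubgroup.Gamma0 N, A q.out⁻¹ ≤ B := by
    obtain ⟨B, hB⟩ := (Set.finite_range fun q : SL(2, ℤ) ⧸ CongruenceSubgroup.Gamma0 N =>
      A q.out⁻¹).bddAbove
    exact ⟨B, fun q => hB ⟨q, rfl⟩⟩
  -- one exponent works at all cusps, since there are finitely many cosets
  set t : ℝ := max 0 (k / 2 + B) with ht
  have hinf : ∀ g : SL(2, ℤ), (fun τ => invNorm k f (g • τ)) =O[UpperHalfPlane.atImInfty]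
      fun τ : ℍ => τ.im ^ t := by
    intro g
    obtain ⟨h, hh⟩ := QuotientGroup.mk_out_eq_mul (CongruenceSubgroup.Gamma0 N) g⁻¹
    set q : SL(2, ℤ) ⧸ CongruenceSubgroup.Gamma0 N := QuotientGroup.mk g⁻¹ with hq
    have hqg : q.out⁻¹ = ((h⁻¹ : CongruenceSubgroup.Gamma0 N) : SL(2, ℤ)) * g := by
      rw [hh]; simp
    have e : ∀ τ : ℍ, invNorm k f (g • τ) = τ.im ^ (k / 2) * ‖plainSlash k f q.out⁻¹ τ‖ := by
      intro τ
      rw [← invNorm_smul, hqg, mul_smul, hf.invNorm_smul_eq]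
    simp_rw [e]
    have h1 : (fun τ : ℍ => τ.im ^ (k / 2) * ‖plainSlash k f q.out⁻¹ τ‖)
        =O[UpperHalfPlane.atImInfty] fun τ : ℍ => τ.im ^ (k / 2) * τ.im ^ (A q.out⁻¹) :=
      (isBigO_refl _ _).mul (hA q.out⁻¹).norm_left
    refine h1.trans (IsBigO.of_bound 1 ?_)
    filter_upwards [(UpperHalfPlane.atImInfty_mem _).2 ⟨1, fun τ hτ => hτ⟩] with τ (hτ : 1 ≤ τ.im)
    have := τ.im_pos
    rw [one_mul, ← Real.rpow_add τ.im_pos, Real.norm_of_nonneg (by positivity),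
      Real.norm_of_nonneg (by positivity)]
    exact Real.rpow_le_rpow_of_exponent_le hτ
      (le_max_of_le_right (by linarith [hB q]))
  obtain ⟨C, hC⟩ := ModularGroup.exists_bound_of_subgroup_invariant_of_isBigO
    (continuous_invNorm (k := k) hf.continuous) (le_max_left _ _) hinf
    (Γ := CongruenceSubgroup.Gamma0 N) fun g hg τ => hf.invNorm_smul_eq ⟨g, hg⟩ τ
  exact ⟨C, t, le_max_left _ _, fun τ => (le_abs_self _).trans (hC τ)⟩

lemma IsHarmonicMaassForm.moderateGrowth (hN : 0 < N) (hf : IsHarmonicMaassForm m N χ f) :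
    ModerateGrowth ((m : ℝ) / 2) f := by
  obtain ⟨C, t, ht, h⟩ := hf.exists_invNorm_le hN
  refine ⟨|C|, t, abs_nonneg C, ht, fun τ _ _ => (h τ).trans ?_⟩
  have := τ.im_pos
  gcongr
  exact le_abs_self C

/-- The point `-1/(Nτ)`. -/
noncomputable def frickePoint (N : ℕ) (τ : ℍ) : ℍ :=
  UpperHalfPlane.ofComplex (-1 / ((N : ℂ) * (τ : ℂ)))

lemma im_neg_one_div (N : ℕ) (z : ℂ) :
    (-1 / ((N : ℂ) * z)).im = z.im / (N * ‖z‖ ^ 2) := by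
  rcases eq_or_ne (N : ℂ) 0 with h | h
  · have : (N : ℝ) = 0 := by exact_mod_cast h
    simp [h, this]
  have h' : (N : ℝ) ≠ 0 := by exact_mod_cast h
  rw [← normSq_eq_norm_sq, div_eq_mul_inv, Complex.mul_im, Complex.inv_re, Complex.inv_im]
  simp [Complex.normSq_mul]
  field_simp

lemma coe_frickePoint (hN : 0 < N) (τ : ℍ) :
    ((frickePoint N τ : ℍ) : ℂ) = -1 / ((N : ℂ) * (τ : ℂ)) := by
  have h : 0 < (-1 / ((N : ℂ) * (τ : ℂ))).im := by
    have h1 : 0 < ‖(τ : ℂ)‖ := norm_pos_iff.2 τ.ne_zero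
    have h2 : 0 < (τ : ℂ).im := τ.im_pos
    rw [im_neg_one_div]
    positivity
  rw [frickePoint, UpperHalfPlane.ofComplex_apply_of_im_pos h]

lemma im_frickePoint (hN : 0 < N) (τ : ℍ) :
    (frickePoint N τ).im = τ.im / (N * ‖(τ : ℂ)‖ ^ 2) := by
  rw [← UpperHalfPlane.coe_im, coe_frickePoint hN, im_neg_one_div, UpperHalfPlane.coe_im]

lemma invNorm_fricke (hN : 0 < N) (k : ℝ) (f : ℍ → ℂ) (τ : ℍ) :
    invNorm k (fricke k N f) τ = invNorm k f (frickePoint N τ) := by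
  have hN' : (0 : ℝ) < N := by exact_mod_cast hN
  have h1 : 0 < ‖(τ : ℂ)‖ := norm_pos_iff.2 τ.ne_zero
  have h2 := τ.im_pos
  rw [invNorm, invNorm, im_frickePoint hN, fricke, ← frickePoint, norm_mul, norm_mul,
    ← ofReal_neg, norm_cpow_real, norm_mul, norm_natCast,
    show (k : ℂ) / 2 = ((k / 2 : ℝ) : ℂ) by push_cast; rfl, norm_cpow_real, norm_natCast,
    Real.div_rpow h2.le (by positivity), Real.mul_rpow hN'.le h1.le,
    Real.mul_rpow hN'.le (by positivity : 0 ≤ ‖(τ : ℂ)‖ ^ 2), ← Real.rpow_natCast ‖(τ : ℂ)‖ 2,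
    ← Real.rpow_mul h1.le,
    show ((2 : ℕ) : ℝ) * (k / 2) = k by push_cast; ring, Real.rpow_neg hN'.le,
    Real.rpow_neg h1.le]
  have h3 : (N : ℝ) ^ k = (N : ℝ) ^ (k / 2) * (N : ℝ) ^ (k / 2) := by
    rw [← Real.rpow_add hN']; congr 1; ring
  have h4 : (N : ℝ) ^ (k / 2) ≠ 0 := by positivity
  have h5 : ‖(τ : ℂ)‖ ^ k ≠ 0 := by positivity
  rw [h3]
  field_simp

lemma IsHarmonicMaassForm.moderateGrowth_fricke (hN : 0 < N) (hf : IsHarmonicMaassForm m N χ f) :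
    ModerateGrowth ((m : ℝ) / 2) (fricke ((m : ℝ) / 2) N f) := by
  obtain ⟨C, t, ht, h⟩ := hf.exists_invNorm_le hN
  have hN' : (1 : ℝ) ≤ N := by exact_mod_cast hN
  refine ⟨|C| * (2 * N : ℝ) ^ t, t, by positivity, ht, fun τ hx0 hx1 => ?_⟩
  rw [invNorm_fricke hN]
  refine (h _).trans ?_
  have hy := τ.im_pos
  set y := τ.im
  have hn : ‖(τ : ℂ)‖ ^ 2 = τ.re ^ 2 + y ^ 2 := by
    rw [← normSq_eq_norm_sq, normSq_apply]
    simp [y, sq]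
  have hM1 : y ≤ max y (1 / y) := le_max_left _ _
  have hM2 : 1 / y ≤ max y (1 / y) := le_max_right _ _
  have hM : 0 < max y (1 / y) := lt_max_of_lt_left hy
  have hw := (frickePoint N τ).im_pos
  have hb : max (frickePoint N τ).im (1 / (frickePoint N τ).im) ≤ 2 * N * max y (1 / y) := by
    rw [im_frickePoint hN, hn]
    refine max_le ?_ ?_
    · calc y / (N * (τ.re ^ 2 + y ^ 2)) ≤ y / (1 * (0 + y ^ 2)) := by
            gcongr
            positivity
        _ = 1 * (1 / y) := by field_simp; ring
        _ ≤ 2 * N * max y (1 / y) := by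
            gcongr
            linarith
    · calc 1 / (y / (N * (τ.re ^ 2 + y ^ 2))) = N * (τ.re ^ 2 * (1 / y) + y) := by
            field_simp
        _ ≤ N * (1 * max y (1 / y) + max y (1 / y)) := by
            gcongr
            nlinarith
        _ = _ := by ring
  calc C * max (frickePoint N τ).im (1 / (frickePoint N τ).im) ^ t
      ≤ |C| * (2 * N * max y (1 / y)) ^ t := by
        gcongr
        exact le_abs_self C
    _ = _ := by rw [Real.mul_rpow (by positivity) hM.le]; ring

end form

lemma ModerateGrowth.norm_le {k : ℝ} {f : ℍ → ℂ} (h : ModerateGrowth k f) :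
    ∃ C A : ℝ, 0 ≤ C ∧ ∀ x y : ℝ, 0 ≤ x → x ≤ 1 → 0 < y →
      ‖coord f x y‖ ≤ C * max y (1 / y) ^ A := by
  obtain ⟨C, t, hC, ht, h⟩ := h
  refine ⟨C, t + |k / 2|, hC, fun x y hx0 hx1 hy => ?_⟩
  have him : 0 < ((x : ℂ) + (y : ℂ) * I).im := by simpa using hy
  have hτ := h ⟨_, him⟩ (by simpa [UpperHalfPlane.re] using hx0)
    (by simpa [UpperHalfPlane.re] using hx1)
  rw [invNorm, UpperHalfPlane.mk_im] at hτ
  rw [coord, UpperHalfPlane.ofComplex_apply_of_im_pos him]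
  simp only [add_im, ofReal_im, mul_im, ofReal_re, I_im, mul_one, I_re, mul_zero, add_zero,
    zero_add] at hτ
  set M := max y (1 / y) with hM
  have hM0 : 0 < M := lt_max_of_lt_left hy
  have hM1 : 1 ≤ M := by
    rcases le_total 1 y with h1 | h1
    · exact le_max_of_le_left h1
    · exact le_max_of_le_right (by rw [le_div_iff₀ hy]; linarith)
  have hyk : 1 ≤ y ^ (k / 2) * M ^ |k / 2| := by
    have h1 : 1 / M ≤ y := by
      rw [div_le_iff₀ hM0]
      calc (1 : ℝ) = y * (1 / y) := by field_simp
        _ ≤ y * M := by gcongr; exact le_max_right _ _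
    have h2 : y ≤ M := le_max_left _ _
    rcases le_total 0 (k / 2) with h3 | h3
    · rw [abs_of_nonneg h3, ← Real.mul_rpow hy.le hM0.le]
      refine Real.one_le_rpow ?_ h3
      rwa [div_le_iff₀ hM0] at h1
    · rw [abs_of_nonpos h3, Real.rpow_neg hM0.le, ← div_eq_mul_inv, le_div_iff₀ (by positivity),
        one_mul]
      exact Real.rpow_le_rpow_of_nonpos hy h2 h3
  set w := ‖f ⟨(x : ℂ) + (y : ℂ) * I, him⟩‖
  calc w = 1 * w := (one_mul w).symm
    _ ≤ (y ^ (k / 2) * M ^ |k / 2|) * w := by gcongr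
    _ = (y ^ (k / 2) * w) * M ^ |k / 2| := by ring
    _ ≤ (C * M ^ t) * M ^ |k / 2| := by gcongr
    _ = C * M ^ (t + |k / 2|) := by rw [Real.rpow_add hM0]; ring

/-! ### Fourier coefficients in `x` -/

/-- The function `x ↦ e^{2πijx}`. -/
noncomputable def expChar (j : ℤ) (x : ℝ) : ℂ := Complex.exp (2 * Real.pi * I * j * x)

lemma norm_expChar (j : ℤ) (x : ℝ) : ‖expChar j x‖ = 1 := by
  rw [expChar, show (2 * Real.pi * I * j * x : ℂ) = ((2 * Real.pi * j * x : ℝ) : ℂ) * I by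
    push_cast; ring, norm_exp_ofReal_mul_I]

lemma expChar_mul (i j : ℤ) (x : ℝ) : expChar i x * expChar j x = expChar (i + j) x := by
  simp only [expChar, ← Complex.exp_add]
  congr 1; push_cast; ring

lemma continuous_expChar (j : ℤ) : Continuous (expChar j) := by
  unfold expChar; fun_prop

lemma hasDerivAt_expChar (j : ℤ) (x : ℝ) :
    HasDerivAt (expChar j) (2 * Real.pi * I * j * expChar j x) x := by
  have h : HasDerivAt (fun z : ℂ => Complex.exp (2 * Real.pi * I * j * z))
      (Complex.exp (2 * Real.pi * I * j * x) * (2 * Real.pi * I * j * 1)) (x : ℂ) :=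
    ((hasDerivAt_id _).const_mul _).cexp
  refine h.comp_ofReal.congr_deriv ?_
  rw [mul_one, mul_comm, expChar]

lemma expChar_zero_right (j : ℤ) : expChar j 0 = 1 := by simp [expChar]

lemma expChar_one_right (j : ℤ) : expChar j 1 = 1 := by
  rw [expChar, show (2 * Real.pi * I * j * (1 : ℝ) : ℂ) = j * (2 * Real.pi * I) by
    push_cast; ring, exp_int_mul_two_pi_mul_I]

lemma integral_expChar (j : ℤ) : ∫ x in (0 : ℝ)..1, expChar j x = if j = 0 then 1 else 0 := by
  split_ifs with h
  · simp [h, expChar]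
  · have hj : (2 * Real.pi * I * j : ℂ) ≠ 0 := by simp [Real.pi_ne_zero, h]
    have := integral_exp_mul_complex (a := 0) (b := 1) hj
    simp only [expChar]
    rw [this]
    have h1 := expChar_one_right j
    simp only [expChar] at h1
    rw [h1]
    simp

/-- The `j`-th Fourier coefficient `∫_0^1 F(x, y) e^{-2πijx} dx` on the horizontal line of height
`y`. -/
noncomputable def fourierCoef (F : ℝ → ℝ → ℂ) (j : ℤ) (y : ℝ) : ℂ :=
  ∫ x in (0 : ℝ)..1, F x y * expChar (-j) x

lemma fourierCoef_eq_of_hasSum {F : ℝ → ℝ → ℂ} {y : ℝ} {C : ℤ → ℂ} (hC : Summable C)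
    (h : ∀ x : ℝ, HasSum (fun j => C j * expChar j x) (F x y)) (n : ℤ) :
    fourierCoef F n y = C n := by
  have h1 := intervalIntegral.hasSum_integral_of_dominated_convergence (μ := volume)
    (a := (0 : ℝ)) (b := 1)
    (F := fun (j : ℤ) (x : ℝ) => C j * expChar j x * expChar (-n) x)
    (f := fun x => F x y * expChar (-n) x) (fun j _ => ‖C j‖)
    (fun j => (((continuous_expChar j).const_mul (C j)).mul
      (continuous_expChar (-n))).aestronglyMeasurable)
    (fun j => Eventually.of_forall fun x _ => by simp [norm_expChar])
    (Eventually.of_forall fun x _ => hC.norm)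
    intervalIntegrable_const
    (Eventually.of_forall fun x _ => (h x).mul_right _)
  have h2 : ∀ j : ℤ, ∫ x in (0 : ℝ)..1, C j * expChar j x * expChar (-n) x
      = if j = n then C n else 0 := by
    intro j
    simp_rw [mul_assoc, expChar_mul]
    rw [intervalIntegral.integral_const_mul, integral_expChar]
    by_cases hj : j = n
    · simp [hj]
    · simp [hj, ← sub_eq_add_neg, sub_eq_zero]
  simp_rw [h2] at h1
  exact h1.unique (hasSum_ite_eq n (C n))

lemma hasSum_fourierCoef {F : ℝ → ℝ → ℂ} {y : ℝ} (hcont : Continuous fun x => F x y)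
    (hper : ∀ x, F (x + 1) y = F x y) (hs : Summable fun j => fourierCoef F j y) (x : ℝ) :
    HasSum (fun j => fourierCoef F j y * expChar j x) (F x y) := by
  have hp : Function.Periodic (fun x => F x y) 1 := hper
  have hc : Continuous hp.lift := continuous_coinduced_dom.2 hcont
  set Φ : C(AddCircle (1 : ℝ), ℂ) := ⟨hp.lift, hc⟩ with hΦ
  have hΦx : ∀ x : ℝ, Φ (x : AddCircle (1 : ℝ)) = F x y := fun x => hp.lift_coe x
  have hcoef : ∀ j : ℤ, fourierCoeff Φ j = fourierCoef F j y := by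
    intro j
    rw [fourierCoeff_eq_intervalIntegral Φ j 0, fourierCoef]
    simp only [zero_add, div_one, one_smul]
    refine intervalIntegral.integral_congr fun x _ => ?_
    simp only [hΦx, fourier_coe_apply, expChar, smul_eq_mul, ofReal_one, div_one]
    rw [mul_comm]
  have := has_pointwise_sum_fourier_series_of_summable (f := Φ)
    (by simpa only [funext hcoef] using! hs) (x : AddCircle (1 : ℝ))
  rw [hΦx] at this
  refine this.congr_fun fun j => ?_
  rw [hcoef, fourier_coe_apply, smul_eq_mul, expChar]
  simp

/-! ### Fourier expansions and Fourier coefficients -/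

/-- The coefficient of `e^{2πijx}` in the expansion with coefficients `a^±`, at height `y`. -/
noncomputable def expansionCoef (k : ℝ) (ap am : ℕ → ℂ) (j : ℤ) (y : ℝ) : ℂ :=
  if j = 0 then ap 0 + am 0 * ((y ^ (1 - k) : ℝ) : ℂ)
  else (if 0 < j then ap j.natAbs
    else am j.natAbs * (incGamma (1 - k) (4 * Real.pi * j.natAbs * y) : ℂ))
      * (Real.exp (-(2 * Real.pi * j * y)) : ℂ)

section expansion

variable {k : ℝ} {f : ℍ → ℂ} {ap am : ℕ → ℂ}

lemma expansionCoef_add_one (n : ℕ) (y : ℝ) : expansionCoef k ap am (n + 1) y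
    = ap (n + 1) * kernelPlus (2 * Real.pi * (n + 1 : ℕ) * y) := by
  have h0 : ((n : ℤ) + 1) ≠ 0 := by omega
  have h1 : 0 < (n : ℤ) + 1 := by omega
  have h2 : ((n : ℤ) + 1).natAbs = n + 1 := by omega
  rw [expansionCoef, if_neg h0, if_pos h1, h2, kernelPlus]
  push_cast
  rfl

lemma expansionCoef_neg_add_one (n : ℕ) (y : ℝ) : expansionCoef k ap am (-(n + 1)) y
    = am (n + 1) * kernelMinus k (2 * Real.pi * (n + 1 : ℕ) * y) := by
  have h0 : -((n : ℤ) + 1) ≠ 0 := by omega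
  have h1 : ¬ 0 < -((n : ℤ) + 1) := by omega
  have h2 : (-((n : ℤ) + 1)).natAbs = n + 1 := by omega
  rw [expansionCoef, if_neg h0, if_neg h1, h2, kernelMinus, mul_assoc, ← ofReal_mul]
  congr 4
  · ring
  · push_cast; ring

lemma qpow_eq (j : ℤ) (τ : ℍ) :
    qpow j τ = (Real.exp (-(2 * Real.pi * j * τ.im)) : ℂ) * expChar j τ.re := by
  rw [qpow, expChar, ofReal_exp, ← Complex.exp_add]
  congr 1
  rw [← UpperHalfPlane.re_add_im τ]
  push_cast
  linear_combination (2 * Real.pi * j * (τ.im : ℂ)) * I_mul_I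

lemma plusTerm_eq (n : ℕ) (τ : ℍ) : ap (n + 1) * qpow (n + 1 : ℕ) τ
    = expansionCoef k ap am (n + 1) τ.im * expChar (n + 1) τ.re := by
  rw [qpow_eq, expansionCoef_add_one, kernelPlus]
  push_cast
  ring

lemma minusTerm_eq (n : ℕ) (τ : ℍ) : minusTerm k am (n + 1) τ
    = expansionCoef k ap am (-(n + 1)) τ.im * expChar (-(n + 1)) τ.re := by
  rw [minusTerm, qpow_eq, expansionCoef_neg_add_one, kernelMinus]
  push_cast
  rw [show (2 : ℝ) * (2 * Real.pi * (n + 1) * τ.im) = 4 * Real.pi * (n + 1) * τ.im by ring,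
    show -(2 * (Real.pi : ℂ) * -((n : ℂ) + 1) * τ.im) = 2 * Real.pi * (n + 1) * τ.im by ring]
  ring

/-- All Fourier coefficients of `f` are those prescribed by `a^±`. -/
def HasFourierCoefs (k : ℝ) (f : ℍ → ℂ) (ap am : ℕ → ℂ) : Prop :=
  ∀ (j : ℤ) (y : ℝ), 0 < y → fourierCoef (coord f) j y = expansionCoef k ap am j y

lemma coord_eq (f : ℍ → ℂ) (x : ℝ) {y : ℝ} (hy : 0 < y) :
    ∃ τ : ℍ, τ.re = x ∧ τ.im = y ∧ coord f x y = f τ := by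
  have him : 0 < ((x : ℂ) + (y : ℂ) * I).im := by simpa using hy
  refine ⟨⟨_, him⟩, by simp [UpperHalfPlane.re], by simp [UpperHalfPlane.im], ?_⟩
  rw [coord, UpperHalfPlane.ofComplex_apply_of_im_pos him]

lemma coord_re_im (f : ℍ → ℂ) (τ : ℍ) : coord f τ.re τ.im = f τ := by
  rw [coord, UpperHalfPlane.re_add_im, UpperHalfPlane.ofComplex_apply]

lemma HasExpansion.hasFourierCoefs (h : HasExpansion k f ap am) : HasFourierCoefs k f ap am := by
  intro j y hy
  have h0 : qpow (0 : ℕ) = fun _ => 1 := by funext τ; simp [qpow]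
  have hsum : Summable fun j : ℤ => expansionCoef k ap am j y := by
    obtain ⟨τ, hre, him, -⟩ := coord_eq f 0 hy
    have s1 := (summable_nat_add_iff 1).2 (h.summable_plus τ)
    have s2 := h.summable_minus τ
    refine Summable.of_add_one_of_neg_add_one ?_ ?_
    · refine s1.congr fun n => ?_
      rw [plusTerm_eq (k := k) (am := am), hre, him, expChar_zero_right, mul_one]
    · refine s2.congr fun n => ?_
      rw [minusTerm_eq (ap := ap), hre, him, expChar_zero_right, mul_one]
  refine fourierCoef_eq_of_hasSum hsum (fun x => ?_) j
  obtain ⟨τ, hre, him, hτ⟩ := coord_eq f x hy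
  have s1 := ((summable_nat_add_iff 1).2 (h.summable_plus τ)).hasSum
  have s2 := (h.summable_minus τ).hasSum
  have e : coord f x y = (∑' n : ℕ, ap (n + 1) * qpow (n + 1 : ℕ) τ)
      + expansionCoef k ap am 0 y * expChar 0 x + ∑' n : ℕ, minusTerm k am (n + 1) τ := by
    rw [hτ, h.eq τ, (h.summable_plus τ).tsum_eq_zero_add, h0, him]
    simp [expansionCoef, expChar]
    ring
  rw [e]
  refine HasSum.of_add_one_of_neg_add_one (f := fun j => expansionCoef k ap am j y * expChar j x)
    ?_ ?_
  · simpa only [plusTerm_eq (k := k) (am := am), hre, him] using s1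
  · simpa only [minusTerm_eq (ap := ap), hre, him] using s2

/-- The Fourier coefficients at height `1/n` grow at most polynomially in `n`. -/
lemma ModerateGrowth.exists_polyBound (hf : ModerateGrowth k f) {c : ℕ → ℂ} {w : ℂ} (hw : w ≠ 0)
    (ι : ℕ → ℤ)
    (hc : ∀ n : ℕ, fourierCoef (coord f) (ι n) (1 / (n + 1 : ℕ)) = c (n + 1) * w) :
    ∃ μ : ℝ, PolyBound c μ := by
  obtain ⟨C, A, hC, h⟩ := hf.norm_le
  refine ⟨A, IsBigO.of_bound (C / ‖w‖) ?_⟩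
  filter_upwards [eventually_ge_atTop 1] with n hn
  obtain ⟨n, rfl⟩ : ∃ n', n = n' + 1 := ⟨n - 1, by omega⟩
  have hn1 : (1 : ℝ) ≤ (n + 1 : ℕ) := by exact_mod_cast hn
  set t : ℝ := ((n + 1 : ℕ) : ℝ)
  have ht : 0 < t := by linarith
  have hmax : max (1 / t) (1 / (1 / t)) = t := by
    rw [one_div_one_div]
    refine max_eq_right ?_
    rw [div_le_iff₀ ht]
    nlinarith
  have hb : ‖fourierCoef (coord f) (ι n) (1 / t)‖ ≤ C * t ^ A := by
    have := intervalIntegral.norm_integral_le_of_norm_le_const (a := (0 : ℝ)) (b := 1)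
      (C := C * t ^ A) (f := fun x => coord f x (1 / t) * expChar (-(ι n)) x) (fun x hx => ?_)
    · simpa [fourierCoef] using this
    · rw [Set.uIoc_of_le zero_le_one] at hx
      rw [norm_mul, norm_expChar, mul_one]
      have := h x (1 / t) hx.1.le hx.2 (by positivity)
      rwa [hmax] at this
  rw [hc n, norm_mul] at hb
  rw [Real.norm_of_nonneg (by positivity), div_mul_eq_mul_div, le_div_iff₀ (norm_pos_iff.2 hw)]
  exact hb

lemma HasFourierCoefs.exists_polyBound (h : HasFourierCoefs k f ap am)
    (hf : ModerateGrowth k f) : (∃ μ, PolyBound ap μ) ∧ ∃ μ, PolyBound am μ := by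
  have hd : ∀ n : ℕ, 2 * Real.pi * (n + 1 : ℕ) * (1 / (n + 1 : ℕ)) = 2 * Real.pi := by
    intro n
    have : ((n + 1 : ℕ) : ℝ) ≠ 0 := by positivity
    field_simp
  constructor
  · refine hf.exists_polyBound (w := kernelPlus (2 * Real.pi)) ?_ (fun n => (n + 1 : ℤ))
      fun n => ?_
    · exact ofReal_ne_zero.2 (Real.exp_ne_zero _)
    · rw [h _ _ (by positivity), expansionCoef_add_one, hd]
  · refine hf.exists_polyBound (w := kernelMinus k (2 * Real.pi)) ?_ (fun n => -(n + 1 : ℤ))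
      fun n => ?_
    · refine ofReal_ne_zero.2 (mul_ne_zero ?_ (Real.exp_ne_zero _))
      exact (incGamma_pos _ (by positivity)).ne'
    · rw [h _ _ (by positivity), expansionCoef_neg_add_one, hd]

/-- Moderate growth bounds the coefficients, which makes the Fourier series converge absolutely. -/
lemma HasFourierCoefs.hasExpansion (h : HasFourierCoefs k f ap am) (hf : ModerateGrowth k f)
    (hcont : Continuous f) (hper : ∀ (x : ℝ) {y : ℝ}, 0 < y → coord f (x + 1) y = coord f x y) :
    HasExpansion k f ap am := by
  obtain ⟨⟨μp, hp⟩, ⟨μm, hm⟩⟩ := h.exists_polyBound hf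
  have s1 : ∀ {y : ℝ}, 0 < y → Summable fun n : ℕ => expansionCoef k ap am (n + 1) y := by
    intro y hy
    simp_rw [expansionCoef_add_one]
    exact isKernel_kernelPlus.summable_dilates le_rfl hp (by positivity) hy
  have s2 : ∀ {y : ℝ}, 0 < y → Summable fun n : ℕ => expansionCoef k ap am (-(n + 1)) y := by
    intro y hy
    simp_rw [expansionCoef_neg_add_one]
    exact (isKernel_kernelMinus (le_max_left 0 k)
      (lt_max_of_lt_right (by linarith : k - 1 < k))).summable_dilates (le_max_left 0 k) hm
      (by positivity) hy
  have t1 : ∀ τ : ℍ, Summable fun n : ℕ => ap (n + 1) * qpow (n + 1 : ℕ) τ := fun τ => by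
    refine Summable.of_norm_bounded (s1 τ.im_pos).norm fun n => ?_
    rw [plusTerm_eq (k := k) (am := am), norm_mul, norm_expChar, mul_one]
  have t2 : ∀ τ : ℍ, Summable fun n : ℕ => minusTerm k am (n + 1) τ := fun τ => by
    refine Summable.of_norm_bounded (s2 τ.im_pos).norm fun n => ?_
    rw [minusTerm_eq (ap := ap), norm_mul, norm_expChar, mul_one]
  have t1' : ∀ τ : ℍ, Summable fun n : ℕ => ap n * qpow n τ := fun τ =>
    (summable_nat_add_iff 1).1 (t1 τ)
  refine ⟨t1', t2, fun τ => ?_⟩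
  have hy := τ.im_pos
  have hc : Continuous fun x : ℝ => coord f x τ.im := by
    have hg : Continuous fun x : ℝ => (⟨(x : ℂ) + (τ.im : ℂ) * I, by simpa using hy⟩ : ℍ) :=
      UpperHalfPlane.isEmbedding_coe.continuous_iff.2 (by
        simp only [Function.comp_def]; fun_prop)
    refine (hcont.comp hg).congr fun x => ?_
    rw [coord, UpperHalfPlane.ofComplex_apply_of_im_pos]
    rfl
  have hsum : Summable fun j : ℤ => fourierCoef (coord f) j τ.im := by
    simp_rw [h _ _ hy]
    exact Summable.of_add_one_of_neg_add_one (s1 hy) (s2 hy)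
  have hs := hasSum_fourierCoef hc (fun x => hper x hy) hsum τ.re
  rw [coord_re_im] at hs
  simp_rw [h _ _ hy] at hs
  have hs' : HasSum (fun j => expansionCoef k ap am j τ.im * expChar j τ.re)
      ((∑' n : ℕ, ap (n + 1) * qpow (n + 1 : ℕ) τ) + expansionCoef k ap am 0 τ.im * expChar 0 τ.re
        + ∑' n : ℕ, minusTerm k am (n + 1) τ) := HasSum.of_add_one_of_neg_add_one
    (f := fun j => expansionCoef k ap am j τ.im * expChar j τ.re)
    (by simpa only [plusTerm_eq (k := k) (am := am)] using (t1 τ).hasSum)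
    (by simpa only [minusTerm_eq (ap := ap)] using (t2 τ).hasSum)
  rw [hs.unique hs', (t1' τ).tsum_eq_zero_add]
  have h0 : qpow (0 : ℕ) τ = 1 := by simp [qpow]
  rw [h0]
  simp [expansionCoef, expChar]
  ring

end expansion

/-! ### The differential equation of a Fourier coefficient -/

lemma eq_const_of_hasDerivAt_zero {p : ℝ → ℂ} (h : ∀ y : ℝ, 0 < y → HasDerivAt p 0 y) :
    ∃ D : ℂ, ∀ y : ℝ, 0 < y → p y = D := by
  refine ⟨p 1, fun y hy => ?_⟩
  exact isOpen_Ioi.is_const_of_deriv_eq_zero (convex_Ioi (0 : ℝ)).isPreconnected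
    (fun z hz => (h z hz).differentiableAt.differentiableWithinAt)
    (fun z hz => (h z hz).deriv) hy (Set.mem_Ioi.2 one_pos)

lemma hasDerivAt_ofReal_exp_mul (l y : ℝ) :
    HasDerivAt (fun y : ℝ => ((Real.exp (l * y) : ℝ) : ℂ))
      ((l : ℂ) * (Real.exp (l * y) : ℝ)) y := by
  have h : HasDerivAt (fun y : ℝ => Real.exp (l * y)) (Real.exp (l * y) * (l * 1)) y :=
    ((hasDerivAt_id y).const_mul l).exp
  convert! h.ofReal_comp using 1
  push_cast
  ring

lemma not_forall_exp_le {l : ℝ} (hl : 0 < l) (C A : ℝ) :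
    ¬ ∀ y : ℝ, 1 ≤ y → Real.exp (l * y) ≤ C * y ^ A := by
  intro h
  have h1 := (isLittleO_rpow_exp_pos_mul_atTop A hl).def (c := 1 / (2 * (|C| + 1))) (by positivity)
  obtain ⟨y, hy, hy1⟩ := (h1.and (eventually_ge_atTop 1)).exists
  have hy0 : 0 < y := by linarith
  rw [Real.norm_of_nonneg (by positivity), Real.norm_of_nonneg (by positivity)] at hy
  have h2 := h y hy1
  have h3 : C * y ^ A ≤ (|C| + 1) * y ^ A := by
    gcongr
    linarith [le_abs_self C]
  have h4 : (|C| + 1) * y ^ A ≤ (|C| + 1) * (1 / (2 * (|C| + 1)) * Real.exp (l * y)) := by gcongr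
  have h5 : (|C| + 1) * (1 / (2 * (|C| + 1)) * Real.exp (l * y)) = Real.exp (l * y) / 2 := by
    have : |C| + 1 ≠ 0 := by positivity
    field_simp
  have := Real.exp_pos (l * y)
  linarith

section ode

variable {k l : ℝ} {c u : ℝ → ℂ}

/-- The first order system satisfied by the `j`-th Fourier coefficients `c` of a harmonic function
`f` and `u` of its shadow `y^k (∂_x + i∂_y) f`, where `l = 2πj`: the first equation is the
antiholomorphy of the shadow and the second one its definition. -/
structure IsCoefODE (k l : ℝ) (c u : ℝ → ℂ) : Prop where
  deriv_u : ∀ y : ℝ, 0 < y → HasDerivAt u (l * u y) y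
  deriv_c : ∀ y : ℝ, 0 < y → HasDerivAt c (-I * ((y ^ (-k) : ℝ) : ℂ) * u y - l * c y) y
  growth : ∃ C A : ℝ, 0 ≤ C ∧ ∀ y : ℝ, 1 ≤ y → ‖c y‖ ≤ C * y ^ A

/-- The function `u` is a multiple of `e^{ly}`, so that the second equation becomes explicit. -/
lemma IsCoefODE.exists_hasDerivAt (h : IsCoefODE k l c u) : ∃ K : ℂ, ∀ y : ℝ, 0 < y →
    HasDerivAt (fun y : ℝ => (Real.exp (l * y) : ℂ) * c y)
      (K * ((y ^ (-k) * Real.exp (2 * l * y) : ℝ) : ℂ)) y := by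
  obtain ⟨K, hK⟩ := eq_const_of_hasDerivAt_zero
    (p := fun y : ℝ => (Real.exp (-l * y) : ℂ) * u y) fun y hy => by
      refine ((hasDerivAt_ofReal_exp_mul (-l) y).mul (h.deriv_u y hy)).congr_deriv ?_
      push_cast; ring
  refine ⟨-I * K, fun y hy => ?_⟩
  refine ((hasDerivAt_ofReal_exp_mul l y).mul (h.deriv_c y hy)).congr_deriv ?_
  have e1 : u y = (Real.exp (l * y) : ℂ) * K := by
    rw [← hK y hy, ← mul_assoc, ← ofReal_mul, ← Real.exp_add]
    simp
  have e2 : (Real.exp (2 * l * y) : ℂ) = Real.exp (l * y) * Real.exp (l * y) := by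
    rw [← ofReal_mul, ← Real.exp_add]; congr 2; ring
  rw [ofReal_mul, e1, e2]
  ring

/-- For a positive frequency the second solution grows exponentially. -/
lemma IsCoefODE.exists_eq_kernelPlus (h : IsCoefODE k l c u) (hl : 0 < l) :
    ∃ a : ℂ, ∀ y : ℝ, 0 < y → c y = a * kernelPlus (l * y) := by
  obtain ⟨K, hK⟩ := h.exists_hasDerivAt
  have hK0 : K = 0 := by
    by_contra hK0
    obtain ⟨C, A, hC, hg⟩ := h.growth
    have hKn : 0 < ‖K‖ := norm_pos_iff.2 hK0
    set p : ℝ → ℂ := fun y => (Real.exp (l * y) : ℂ) * c y with hp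
    set P : ℝ → ℝ := fun y => (K⁻¹ * p y).re with hP
    have hPd : ∀ y : ℝ, 0 < y → HasDerivAt P (y ^ (-k) * Real.exp (2 * l * y)) y := by
      intro y hy
      have h1 := (hK y hy).const_mul K⁻¹
      rw [← mul_assoc, inv_mul_cancel₀ hK0, one_mul] at h1
      have h2 := reCLM.hasFDerivAt.comp_hasDerivAt y h1
      exact h2.congr_deriv (ofReal_re _)
    have hPn : ∀ y : ℝ, 1 ≤ y → |P y| ≤ ‖K‖⁻¹ * (Real.exp (l * y) * (C * y ^ |A|)) := by
      intro y hy
      refine (abs_re_le_norm _).trans ?_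
      rw [norm_mul, norm_inv, hp, norm_mul, Complex.norm_real, Real.norm_eq_abs, Real.abs_exp]
      have h1 : y ^ A ≤ y ^ |A| := Real.rpow_le_rpow_of_exponent_le hy (le_abs_self A)
      have := hg y hy
      gcongr
      exact this.trans (by gcongr)
    refine not_forall_exp_le hl
      (2 * ‖K‖⁻¹ * Real.exp l * C * 2 ^ (|A| + |k|)) (|A| + |k|) fun y hy => ?_
    have hy0 : 0 < y := by linarith
    -- on `[y, y + 1]` the slope is of order `e^{2ly}`, but `P` is of order `e^{ly}`
    obtain ⟨ξ, hξ, hξe⟩ := exists_hasDerivAt_eq_slope P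
      (fun y => y ^ (-k) * Real.exp (2 * l * y)) (by linarith : y < y + 1)
      (fun z hz => (hPd z (by linarith [hz.1])).continuousAt.continuousWithinAt)
      (fun z hz => hPd z (by linarith [hz.1]))
    rw [add_sub_cancel_left, div_one] at hξe
    have hξ0 : 0 < ξ := by linarith [hξ.1]
    have lower : (2 * y) ^ (-|k|) * Real.exp (2 * l * y) ≤ ξ ^ (-k) * Real.exp (2 * l * ξ) := by
      have h1 : ξ ^ (-|k|) ≤ ξ ^ (-k) :=
        Real.rpow_le_rpow_of_exponent_le (by linarith [hξ.1]) (by linarith [le_abs_self k])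
      have h2 : (2 * y) ^ (-|k|) ≤ ξ ^ (-|k|) :=
        Real.rpow_le_rpow_of_nonpos hξ0 (by linarith [hξ.2]) (by simp)
      have h3 := hξ.1.le
      gcongr
      exact h2.trans h1
    have upper : P (y + 1) - P y ≤
        2 * (‖K‖⁻¹ * (Real.exp (l * (y + 1)) * (C * (2 * y) ^ |A|))) := by
      have h1 := hPn y hy
      have h2 := hPn (y + 1) (by linarith)
      have h3 : ‖K‖⁻¹ * (Real.exp (l * y) * (C * y ^ |A|)) ≤
          ‖K‖⁻¹ * (Real.exp (l * (y + 1)) * (C * (2 * y) ^ |A|)) := by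
        gcongr <;> linarith
      have h4 : ‖K‖⁻¹ * (Real.exp (l * (y + 1)) * (C * (y + 1) ^ |A|)) ≤
          ‖K‖⁻¹ * (Real.exp (l * (y + 1)) * (C * (2 * y) ^ |A|)) := by
        gcongr; linarith
      have := (abs_le.1 h1).1
      have := (abs_le.1 h2).2
      linarith
    have h5 := lower.trans (hξe.le.trans upper)
    have e1 : Real.exp (2 * l * y) = Real.exp (l * y) * Real.exp (l * y) := by
      rw [← Real.exp_add]; congr 1; ring
    have e2 : Real.exp (l * (y + 1)) = Real.exp (l * y) * Real.exp l := by
      rw [← Real.exp_add]; congr 1; ring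
    rw [e1, e2, Real.rpow_neg (by positivity), inv_mul_le_iff₀ (by positivity)] at h5
    refine le_of_mul_le_mul_left (h5.trans (le_of_eq ?_)) (Real.exp_pos (l * y))
    rw [mul_assoc _ (2 ^ (|A| + |k|) : ℝ), ← Real.mul_rpow (by norm_num) hy0.le,
      Real.rpow_add (by positivity)]
    ring
  obtain ⟨a, ha⟩ := eq_const_of_hasDerivAt_zero
    (p := fun y : ℝ => (Real.exp (l * y) : ℂ) * c y) fun y hy => by
      simpa [hK0] using hK y hy
  refine ⟨a, fun y hy => ?_⟩
  rw [← ha y hy, kernelPlus, mul_right_comm, ← ofReal_mul, ← Real.exp_add]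
  simp

/-- For a negative frequency the solutions are spanned by a growing exponential and
`Γ(1-k, 2ly) e^{ly}`. -/
lemma IsCoefODE.exists_eq_kernelMinus (h : IsCoefODE k (-l) c u) (hl : 0 < l) :
    ∃ a : ℂ, ∀ y : ℝ, 0 < y → c y = a * kernelMinus k (l * y) := by
  obtain ⟨K, hK⟩ := h.exists_hasDerivAt
  set α : ℂ := -K * (((2 * l) ^ (k - 1) : ℝ) : ℂ) with hα
  obtain ⟨D, hD⟩ := eq_const_of_hasDerivAt_zero
    (p := fun y : ℝ => (Real.exp (-l * y) : ℂ) * c y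
      - α * ((incGamma (1 - k) (2 * l * y) : ℝ) : ℂ)) fun y hy => by
      have h1 : HasDerivAt (fun y : ℝ => incGamma (1 - k) (2 * l * y))
          (-((2 * l * y) ^ (1 - k - 1) * Real.exp (-(2 * l * y))) * (2 * l * 1)) y :=
        (hasDerivAt_incGamma (1 - k) (by positivity)).comp y ((hasDerivAt_id y).const_mul (2 * l))
      refine ((hK y hy).sub (h1.ofReal_comp.const_mul α)).congr_deriv ?_
      have e1 : (2 * l * y) ^ (1 - k - 1) = (2 * l) ^ (-k) * y ^ (-k) := by
        rw [← Real.mul_rpow (by positivity) hy.le]; congr 1; ring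
      have e2 : (2 * l) ^ (k - 1) * ((2 * l) ^ (-k) * (2 * l)) = 1 := by
        nth_rewrite 3 [← Real.rpow_one (2 * l)]
        rw [← Real.rpow_add (by positivity), ← Real.rpow_add (by positivity)]
        simp
      have e2' := congrArg ((↑) : ℝ → ℂ) e2
      rw [hα, e1, show 2 * -l * y = -(2 * l * y) by ring]
      push_cast at e2' ⊢
      linear_combination (-K * (y ^ (-k) : ℝ) * Complex.exp (-(2 * l * y))) * e2'
  have hc : ∀ y : ℝ, 0 < y → c y = α * kernelMinus k (l * y) + D * (Real.exp (l * y) : ℂ) := by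
    intro y hy
    have e : (Real.exp (l * y) : ℂ) * (Real.exp (-l * y) : ℂ) = 1 := by
      rw [← ofReal_mul, ← Real.exp_add]; simp
    rw [← hD y hy, kernelMinus, ofReal_mul, show 2 * (l * y) = 2 * l * y by ring]
    linear_combination (-c y) * e
  have hD0 : D = 0 := by
    by_contra hD0
    have hDn : 0 < ‖D‖ := norm_pos_iff.2 hD0
    obtain ⟨C, A, hC, hg⟩ := h.growth
    obtain ⟨C', δ, hC', hδ, hk⟩ := (isKernel_kernelMinus (le_max_left 0 k)
      (lt_max_of_lt_right (by linarith : k - 1 < k))).exists_norm_dilate_le (le_max_left 0 k)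
      hl one_pos
    refine not_forall_exp_le hl (‖D‖⁻¹ * (C + ‖α‖ * C')) |A| fun y hy => ?_
    have hy0 : 0 < y := by linarith
    have h1 : ‖kernelMinus k (l * y)‖ ≤ C' := by
      have := hk 0 y hy
      simp only [zero_add, Nat.cast_one, mul_one] at this
      refine this.trans (mul_le_of_le_one_right hC' ?_)
      rw [← Real.exp_add, Real.exp_le_one_iff]
      nlinarith
    have h2 : ‖D‖ * Real.exp (l * y) ≤ C * y ^ A + ‖α‖ * C' := by
      have e : D * (Real.exp (l * y) : ℂ) = c y - α * kernelMinus k (l * y) := by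
        rw [hc y hy0]; ring
      have e' := congrArg norm e
      rw [norm_mul, Complex.norm_real, Real.norm_eq_abs, Real.abs_exp] at e'
      rw [e']
      refine (norm_sub_le _ _).trans ?_
      rw [norm_mul]
      have := hg y hy
      gcongr
    have h3 : y ^ A ≤ y ^ |A| := Real.rpow_le_rpow_of_exponent_le hy (le_abs_self A)
    have h4 : 1 ≤ y ^ |A| := Real.one_le_rpow hy (abs_nonneg A)
    rw [mul_assoc, ← div_eq_inv_mul, le_div_iff₀ hDn, mul_comm]
    calc ‖D‖ * Real.exp (l * y) ≤ C * y ^ A + ‖α‖ * C' := h2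
      _ ≤ C * y ^ |A| + ‖α‖ * C' * y ^ |A| := by
        gcongr ?_ + ?_
        · gcongr
        · exact le_mul_of_one_le_right (by positivity) h4
      _ = _ := by ring
  exact ⟨α, fun y hy => by rw [hc y hy, hD0, zero_mul, add_zero]⟩

/-- If `k = 1`, the second solution is `log y` instead. -/
lemma IsCoefODE.exists_eq_zero_frequency (h : IsCoefODE k 0 c u) (hk : k ≠ 1) :
    ∃ a b : ℂ, ∀ y : ℝ, 0 < y → c y = a + b * ((y ^ (1 - k) : ℝ) : ℂ) := by
  obtain ⟨K, hK⟩ := h.exists_hasDerivAt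
  have hk' : (1 - k : ℝ) ≠ 0 := sub_ne_zero.2 hk.symm
  have hk'' : (1 - k : ℂ) ≠ 0 := by exact_mod_cast hk'
  obtain ⟨D, hD⟩ := eq_const_of_hasDerivAt_zero
    (p := fun y : ℝ => (Real.exp (0 * y) : ℂ) * c y
      - K / (1 - k) * ((y ^ (1 - k) : ℝ) : ℂ)) fun y hy => by
      have h1 := Real.hasDerivAt_rpow_const (x := y) (p := 1 - k) (Or.inl hy.ne')
      refine ((hK y hy).sub (h1.ofReal_comp.const_mul _)).congr_deriv ?_
      rw [show 1 - k - 1 = -k by ring]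
      push_cast
      field_simp
      simp
  refine ⟨D, K / (1 - k), fun y hy => ?_⟩
  rw [← hD y hy]
  simp

end ode

/-! ### Harmonic functions and their shadows -/

/-- The extension of `f` to `ℂ` used in the definition of `coord`. -/
noncomputable def ext (f : ℍ → ℂ) (z : ℂ) : ℂ := f (UpperHalfPlane.ofComplex z)

/-- The open upper half-plane, as a subset of `ℂ`. -/
def upperHalf : Set ℂ := {z : ℂ | 0 < z.im}

lemma isOpen_upperHalf : IsOpen upperHalf := isOpen_lt continuous_const continuous_im

/-- The Wirtinger derivative `2 ∂F/∂z̄ = (∂_x + i ∂_y) F`. -/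
noncomputable def dbar (F : ℂ → ℂ) (z : ℂ) : ℂ := fderiv ℝ F z 1 + I * fderiv ℝ F z I

/-- `y^k (∂_x + i ∂_y) F`, which is antiholomorphic if and only if `Δ_k F = 0`. -/
noncomputable def shadow (k : ℝ) (F : ℂ → ℂ) (z : ℂ) : ℂ := ((z.im ^ k : ℝ) : ℂ) * dbar F z

/-- Weight `k` harmonicity on the upper half-plane, expressed by the holomorphy of the conjugate of
the shadow. In this form it is visibly stable under weight `k` slash operators. -/
structure IsHarmonic (k : ℝ) (F : ℂ → ℂ) : Prop where
  contDiffOn : ContDiffOn ℝ 2 F upperHalf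
  holo : DifferentiableOn ℂ (fun z => (starRingEnd ℂ) (shadow k F z)) upperHalf

section lines

variable {H : ℂ → ℂ} {x y : ℝ}

lemma hasDerivAt_horizontal (h : DifferentiableAt ℝ H (x + y * I)) :
    HasDerivAt (fun x : ℝ => H (x + y * I)) (fderiv ℝ H (x + y * I) 1) x := by
  have h1 : HasDerivAt (fun x : ℝ => (x : ℂ) + y * I) 1 x :=
    (hasDerivAt_id x).ofReal_comp.add_const _
  exact h.hasFDerivAt.comp_hasDerivAt x h1

lemma hasDerivAt_vertical (h : DifferentiableAt ℝ H (x + y * I)) :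
    HasDerivAt (fun y : ℝ => H (x + y * I)) (fderiv ℝ H (x + y * I) I) y := by
  have h1 : HasDerivAt (fun y : ℝ => (x : ℂ) + y * I) I y := by
    simpa using! ((hasDerivAt_id y).ofReal_comp.mul_const I).const_add (x : ℂ)
  exact h.hasFDerivAt.comp_hasDerivAt y h1

lemma mem_upperHalf_add (x : ℝ) (hy : 0 < y) : (x : ℂ) + y * I ∈ upperHalf := by
  simpa [upperHalf] using hy

end lines

lemma differentiableAt_of_contDiffOn {H : ℂ → ℂ} {n : WithTop ℕ∞} (hn : n ≠ 0)
    (h : ContDiffOn ℝ n H upperHalf) {z : ℂ} (hz : z ∈ upperHalf) : DifferentiableAt ℝ H z :=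
  (h.contDiffAt (isOpen_upperHalf.mem_nhds hz)).differentiableAt hn

lemma contDiffOn_fderiv_apply {H : ℂ → ℂ} (h : ContDiffOn ℝ 2 H upperHalf) (v : ℂ) :
    ContDiffOn ℝ 1 (fun z => fderiv ℝ H z v) upperHalf :=
  (h.fderiv_of_isOpen isOpen_upperHalf (m := 1) (by norm_num)).clm_apply contDiffOn_const

/-- `Δ_k F = -y^{2-k} (∂_x - i∂_y)(y^k (∂_x + i∂_y) F)`. -/
lemma isHarmonic_ext_of_hypLaplacian {k : ℝ} {f : ℍ → ℂ}
    (hs : ContDiffOn ℝ 2 (ext f) upperHalf) (hh : ∀ τ : ℍ, hypLaplacian k f τ = 0) :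
    IsHarmonic k (ext f) := by
  refine ⟨hs, fun z hz => DifferentiableAt.differentiableWithinAt ?_⟩
  set F := ext f with hF
  set D₁ : ℂ → ℂ := fun z => fderiv ℝ F z 1 with hD₁
  set D₂ : ℂ → ℂ := fun z => fderiv ℝ F z I with hD₂
  have hd₁ := fun {w : ℂ} (hw : w ∈ upperHalf) =>
    differentiableAt_of_contDiffOn one_ne_zero (contDiffOn_fderiv_apply hs 1) hw
  have hd₂ := fun {w : ℂ} (hw : w ∈ upperHalf) =>
    differentiableAt_of_contDiffOn one_ne_zero (contDiffOn_fderiv_apply hs I) hw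
  have hd := fun {w : ℂ} (hw : w ∈ upperHalf) =>
    differentiableAt_of_contDiffOn two_ne_zero hs hw
  have hy : 0 < z.im := hz
  have hzeq : (z.re : ℂ) + z.im * I = z := re_add_im z
  -- the equation `Δ_k f = 0` at `z` in terms of Fréchet derivatives
  have hsym : fderiv ℝ D₂ z 1 = fderiv ℝ D₁ z I := by
    have h1 : DifferentiableAt ℝ (fderiv ℝ F) z :=
      ((hs.fderiv_of_isOpen isOpen_upperHalf (m := 1) (by norm_num)).contDiffAt
        (isOpen_upperHalf.mem_nhds hz)).differentiableAt one_ne_zero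
    have h2 : IsSymmSndFDerivAt ℝ F z :=
      (hs.contDiffAt (isOpen_upperHalf.mem_nhds hz)).isSymmSndFDerivAt (by simp)
    have h3 : ∀ v w : ℂ, fderiv ℝ (fun z => fderiv ℝ F z v) z w = fderiv ℝ (fderiv ℝ F) z w v := by
      intro v w
      rw [fderiv_clm_apply h1 (by fun_prop)]
      simp
    rw [hD₂, hD₁, h3, h3]
    exact h2 1 I
  have hlap : -((z.im : ℂ) ^ 2) * (fderiv ℝ D₁ z 1 + fderiv ℝ D₂ z I)
      + I * k * z.im * (D₁ z + I * D₂ z) = 0 := by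
    have h := hh ⟨z, hy⟩
    have it2 : ∀ g : ℝ → ℂ, iteratedDeriv 2 g = deriv (deriv g) := fun g => by
      rw [iteratedDeriv_succ, iteratedDeriv_one]
    have hx1 : deriv (fun x : ℝ => coord f x z.im)
        = fun x : ℝ => D₁ (x + z.im * I) := by
      funext x
      exact (hasDerivAt_horizontal (hd (mem_upperHalf_add x hy))).deriv
    have hy1 : deriv (fun y : ℝ => coord f z.re y) =ᶠ[𝓝 z.im]
        fun y : ℝ => D₂ (z.re + y * I) := by
      filter_upwards [lt_mem_nhds hy] with y hy
      exact (hasDerivAt_vertical (hd (mem_upperHalf_add z.re hy))).deriv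
    have hx2 : deriv (deriv (fun x : ℝ => coord f x z.im)) z.re
        = fderiv ℝ D₁ z 1 := by
      rw [hx1]
      have := (hasDerivAt_horizontal (hd₁ (mem_upperHalf_add z.re hy))).deriv
      rw [this, hzeq]
    have hy2 : deriv (deriv (fun y : ℝ => coord f z.re y)) z.im
        = fderiv ℝ D₂ z I := by
      rw [hy1.deriv_eq]
      have := (hasDerivAt_vertical (hd₂ (mem_upperHalf_add z.re hy))).deriv
      rw [this, hzeq]
    have hx1' := congrFun hx1 z.re
    have hy1' := hy1.eq_of_nhds
    simp only [hzeq] at hx1' hy1'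
    rw [hypLaplacian, it2, it2] at h
    simp only [UpperHalfPlane.mk_re, UpperHalfPlane.mk_im] at h
    rw [hx1', hy1', hx2, hy2] at h
    exact h
  -- the derivative of the shadow
  set p : ℂ → ℂ := fun w => ((w.im ^ k : ℝ) : ℂ) with hp
  have hpd : HasFDerivAt p (((k * z.im ^ (k - 1) : ℝ) : ℂ) • (ofRealCLM.comp imCLM)) z := by
    have h1 : HasFDerivAt (fun w : ℂ => w.im ^ k) ((k * z.im ^ (k - 1)) • imCLM) z :=
      (Real.hasDerivAt_rpow_const (Or.inl hy.ne')).comp_hasFDerivAt z imCLM.hasFDerivAt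
    have h2 := ofRealCLM.hasFDerivAt.comp z h1
    refine h2.congr_fderiv ?_
    ext v
    simp
  have hqd : HasFDerivAt (dbar F) (fderiv ℝ D₁ z + I • fderiv ℝ D₂ z) z :=
    (hd₁ hz).hasFDerivAt.add ((hd₂ hz).hasFDerivAt.const_mul I)
  have hV := hpd.mul hqd
  have hV' : HasFDerivAt (fun w => (starRingEnd ℂ) (shadow k F w)) _ z :=
    conjCLE.toContinuousLinearMap.hasFDerivAt.comp z hV
  rw [differentiableAt_complex_iff_differentiableAt_real]
  refine ⟨hV'.differentiableAt, ?_⟩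
  rw [hV'.fderiv]
  have hpow : ((z.im ^ (k - 1) : ℝ) : ℂ) * z.im = ((z.im ^ k : ℝ) : ℂ) := by
    rw [← ofReal_mul, ← Real.rpow_add_one hy.ne']; simp
  have hne : (z.im : ℂ) ≠ 0 := ofReal_ne_zero.2 hy.ne'
  simp only [ContinuousLinearMap.coe_comp, Function.comp_apply, add_apply,
    smul_apply, smul_eq_mul, ofRealCLM_apply, imCLM_apply, one_im, I_im,
    ContinuousLinearEquiv.coe_coe, conjCLE_apply, ofReal_zero, ofReal_one]
  have hcr : p z * (fderiv ℝ D₁ z I + I * fderiv ℝ D₂ z I)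
      + dbar F z * (((k * z.im ^ (k - 1) : ℝ) : ℂ) * 1)
      = -I * (p z * (fderiv ℝ D₁ z 1 + I * fderiv ℝ D₂ z 1)
      + dbar F z * (((k * z.im ^ (k - 1) : ℝ) : ℂ) * 0)) := by
    have h2 : (z.im : ℂ) ^ 2 ≠ 0 := pow_ne_zero 2 hne
    refine mul_left_cancel₀ h2 ?_
    rw [hsym, show dbar F z = D₁ z + I * D₂ z from rfl, hp]
    simp only
    rw [← hpow]
    push_cast
    linear_combination (-I * ((z.im ^ (k - 1) : ℝ) : ℂ) * z.im) * hlap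
      + (((z.im ^ (k - 1) : ℝ) : ℂ) * z.im * z.im
        * (k * (D₁ z + I * D₂ z) + z.im * fderiv ℝ D₁ z I)) * I_mul_I
  rw [hcr]
  simp

/-! ### Existence of the Fourier expansion -/

lemma continuous_line {H : ℂ → ℂ} (hH : ContinuousOn H upperHalf) {y : ℝ} (hy : 0 < y) :
    Continuous fun x : ℝ => H (x + y * I) :=
  hH.comp_continuous (by fun_prop) fun x => mem_upperHalf_add x hy

lemma intervalIntegrable_line {H : ℂ → ℂ} (hH : ContinuousOn H upperHalf) {y : ℝ} (hy : 0 < y)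
    (j : ℤ) : IntervalIntegrable (fun x : ℝ => H (x + y * I) * expChar j x) volume 0 1 :=
  ((continuous_line hH hy).mul (continuous_expChar j)).intervalIntegrable 0 1

/-- Differentiation under the integral sign. -/
lemma hasDerivAt_fourierCoef {H : ℂ → ℂ} (hH : ContDiffOn ℝ 1 H upperHalf) (j : ℤ) {y : ℝ}
    (hy : 0 < y) : HasDerivAt (fourierCoef (fun x y => H (x + y * I)) j)
      (fourierCoef (fun x y => fderiv ℝ H (x + y * I) I) j y) y := by
  have hH' : ContinuousOn (fun z => fderiv ℝ H z I) upperHalf :=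
    (hH.continuousOn_fderiv_of_isOpen isOpen_upperHalf le_rfl).clm_apply continuousOn_const
  obtain ⟨B, hB⟩ : ∃ B, ∀ p ∈ Set.Icc (0 : ℝ) 1 ×ˢ Set.Icc (y / 2) (2 * y),
      ‖fderiv ℝ H ((p.1 : ℝ) + (p.2 : ℝ) * I) I‖ ≤ B := by
    refine (isCompact_Icc.prod isCompact_Icc).exists_bound_of_continuousOn ?_
    refine hH'.comp (f := fun p : ℝ × ℝ => (p.1 : ℂ) + (p.2 : ℂ) * I) (by fun_prop) fun p hp => ?_
    exact mem_upperHalf_add _ (by linarith [hp.2.1])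
  refine (intervalIntegral.hasDerivAt_integral_of_dominated_loc_of_deriv_le (𝕜 := ℝ)
    (μ := volume)
    (F := fun y x => H (x + y * I) * expChar (-j) x)
    (F' := fun y x => fderiv ℝ H (x + y * I) I * expChar (-j) x) (bound := fun _ => B)
    (s := Set.Ioo (y / 2) (2 * y)) (Ioo_mem_nhds (by linarith) (by linarith)) ?_
    (intervalIntegrable_line hH.continuousOn hy _) ?_ ?_ intervalIntegrable_const ?_).2
  · filter_upwards [lt_mem_nhds hy] with y hy
    exact ((continuous_line hH.continuousOn hy).mul
      (continuous_expChar (-j))).aestronglyMeasurable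
  · exact ((continuous_line hH' hy).mul (continuous_expChar (-j))).aestronglyMeasurable
  · refine Eventually.of_forall fun x hx v hv => ?_
    rw [Set.uIoc_of_le zero_le_one] at hx
    rw [norm_mul, norm_expChar, mul_one]
    exact hB (x, v) ⟨⟨hx.1.le, hx.2⟩, ⟨hv.1.le, hv.2.le⟩⟩
  · refine Eventually.of_forall fun x _ v hv => ?_
    have hv0 : 0 < v := by linarith [hv.1]
    exact (hasDerivAt_vertical
      (differentiableAt_of_contDiffOn one_ne_zero hH (mem_upperHalf_add x hv0))).mul_const _

/-- Integration by parts over a period. -/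
lemma fourierCoef_fderiv_one {H : ℂ → ℂ} (hH : ContDiffOn ℝ 1 H upperHalf)
    (hper : ∀ z, H (z + 1) = H z) (j : ℤ) {y : ℝ} (hy : 0 < y) :
    fourierCoef (fun x y => fderiv ℝ H (x + y * I) 1) j y
      = 2 * Real.pi * I * j * fourierCoef (fun x y => H (x + y * I)) j y := by
  have hH' : ContinuousOn (fun z => fderiv ℝ H z 1) upperHalf :=
    (hH.continuousOn_fderiv_of_isOpen isOpen_upperHalf le_rfl).clm_apply continuousOn_const
  have hd : ∀ x : ℝ, HasDerivAt (fun x : ℝ => H (x + y * I) * expChar (-j) x)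
      (fderiv ℝ H (x + y * I) 1 * expChar (-j) x
        + H (x + y * I) * (2 * Real.pi * I * (-j : ℤ) * expChar (-j) x)) x := fun x =>
    (hasDerivAt_horizontal (differentiableAt_of_contDiffOn one_ne_zero hH
      (mem_upperHalf_add x hy))).mul (hasDerivAt_expChar (-j) x)
  have i1 := intervalIntegrable_line hH' hy (-j)
  have i2 := (intervalIntegrable_line hH.continuousOn hy (-j)).const_mul
    (2 * Real.pi * I * (-j : ℤ))
  have e2 : (fun x : ℝ => H (x + y * I) * (2 * Real.pi * I * (-j : ℤ) * expChar (-j) x))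
      = fun x : ℝ => (2 * Real.pi * I * (-j : ℤ)) * (H (x + y * I) * expChar (-j) x) := by
    funext x; ring
  have key := intervalIntegral.integral_eq_sub_of_hasDerivAt (a := (0 : ℝ)) (b := 1)
    (fun x _ => hd x) (i1.add (by rw [e2]; exact i2))
  rw [intervalIntegral.integral_add i1 (by rw [e2]; exact i2), e2,
    intervalIntegral.integral_const_mul, expChar_one_right, expChar_zero_right] at key
  have hb : H ((1 : ℝ) + y * I) = H ((0 : ℝ) + y * I) := by
    rw [← hper ((0 : ℝ) + y * I)]
    congr 1; push_cast; ring
  rw [hb, sub_self] at key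
  simp only [fourierCoef]
  push_cast at key
  linear_combination key

section existence

variable {k : ℝ} {f : ℍ → ℂ}

lemma shadow_add_one {F : ℂ → ℂ} (hper : ∀ z, F (z + 1) = F z) (z : ℂ) :
    shadow k F (z + 1) = shadow k F z := by
  have h : fderiv ℝ F (z + 1) = fderiv ℝ F z := by
    rw [← fderiv_comp_add_right]
    simp_rw [hper]
  rw [shadow, shadow, dbar, dbar, h]
  simp

lemma IsHarmonic.contDiffOn_shadow {F : ℂ → ℂ} (h : IsHarmonic k F) :
    ContDiffOn ℝ 1 (shadow k F) upperHalf := by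
  have h1 : ContDiffOn ℝ 1 (fun z => (starRingEnd ℂ) (shadow k F z)) upperHalf :=
    (h.holo.contDiffOn isOpen_upperHalf).restrict_scalars ℝ
  have h2 := conjCLE.contDiff.comp_contDiffOn h1
  refine h2.congr fun z _ => ?_
  simp

lemma IsHarmonic.fderiv_shadow {F : ℂ → ℂ} (h : IsHarmonic k F) {z : ℂ} (hz : z ∈ upperHalf) :
    fderiv ℝ (shadow k F) z I = -I * fderiv ℝ (shadow k F) z 1 := by
  have h1 := (differentiableAt_complex_iff_differentiableAt_real.1
    ((h.holo z hz).differentiableAt (isOpen_upperHalf.mem_nhds hz))).2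
  have h2 : HasFDerivAt (fun z => (starRingEnd ℂ) (shadow k F z)) _ z :=
    conjCLE.toContinuousLinearMap.hasFDerivAt.comp z
      (differentiableAt_of_contDiffOn one_ne_zero h.contDiffOn_shadow hz).hasFDerivAt
  rw [h2.fderiv] at h1
  have h3 := congrArg (starRingEnd ℂ) h1
  simpa using h3

lemma isCoefODE_fourierCoef (h : IsHarmonic k (ext f)) (hper : ∀ z, ext f (z + 1) = ext f z)
    (hg : ModerateGrowth k f) (j : ℤ) :
    IsCoefODE k (2 * Real.pi * j) (fourierCoef (coord f) j)
      (fourierCoef (fun x y => shadow k (ext f) (x + y * I)) j) where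
  deriv_u y hy := by
    refine (hasDerivAt_fourierCoef h.contDiffOn_shadow j hy).congr_deriv ?_
    have e : fourierCoef (fun x y => fderiv ℝ (shadow k (ext f)) (x + y * I) I) j y
        = -I * fourierCoef (fun x y => fderiv ℝ (shadow k (ext f)) (x + y * I) 1) j y := by
      simp only [fourierCoef]
      rw [← intervalIntegral.integral_const_mul]
      refine intervalIntegral.integral_congr fun x _ => ?_
      rw [h.fderiv_shadow (mem_upperHalf_add x hy), mul_assoc]
    rw [e, fourierCoef_fderiv_one h.contDiffOn_shadow (shadow_add_one hper) j hy]
    push_cast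
    linear_combination (-2 * Real.pi * j
      * fourierCoef (fun x y => shadow k (ext f) (x + y * I)) j y) * I_mul_I
  deriv_c y hy := by
    have hC1 : ContDiffOn ℝ 1 (ext f) upperHalf := h.contDiffOn.of_le (by norm_num)
    refine (hasDerivAt_fourierCoef hC1 j hy).congr_deriv ?_
    have c1 := (contDiffOn_fderiv_apply h.contDiffOn 1).continuousOn
    have c2 := (contDiffOn_fderiv_apply h.contDiffOn I).continuousOn
    have e : fourierCoef (fun x y => shadow k (ext f) (x + y * I)) j y = ((y ^ k : ℝ) : ℂ) *
        (fourierCoef (fun x y => fderiv ℝ (ext f) (x + y * I) 1) j y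
          + I * fourierCoef (fun x y => fderiv ℝ (ext f) (x + y * I) I) j y) := by
      simp only [fourierCoef]
      rw [← intervalIntegral.integral_const_mul, ← intervalIntegral.integral_add
        (intervalIntegrable_line c1 hy _) ((intervalIntegrable_line c2 hy _).const_mul I),
        ← intervalIntegral.integral_const_mul]
      refine intervalIntegral.integral_congr fun x _ => ?_
      simp [shadow, dbar]
      ring
    have hpow : ((y ^ (-k) : ℝ) : ℂ) * ((y ^ k : ℝ) : ℂ) = 1 := by
      rw [← ofReal_mul, ← Real.rpow_add hy]; simp
    rw [e, fourierCoef_fderiv_one hC1 hper j hy]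
    have e3 : fourierCoef (fun x y => ext f (x + y * I)) j y = fourierCoef (coord f) j y := rfl
    rw [e3]
    push_cast
    set A := fourierCoef (coord f) j y
    set B := fourierCoef (fun x y => fderiv ℝ (ext f) (x + y * I) I) j y
    linear_combination (I * (2 * Real.pi * I * j * A + I * B)) * hpow
      + (2 * Real.pi * j * A + B) * I_mul_I
  growth := by
    obtain ⟨C, A, hC, hb⟩ := hg.norm_le
    refine ⟨C, A, hC, fun y hy => ?_⟩
    have hy0 : 0 < y := by linarith
    have hmax : max y (1 / y) = y := max_eq_left (by rw [div_le_iff₀ hy0]; nlinarith)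
    have := intervalIntegral.norm_integral_le_of_norm_le_const (a := (0 : ℝ)) (b := 1)
      (C := C * y ^ A) (f := fun x => coord f x y * expChar (-j) x) (fun x hx => ?_)
    · simpa [fourierCoef] using this
    · rw [Set.uIoc_of_le zero_le_one] at hx
      rw [norm_mul, norm_expChar, mul_one]
      simpa only [hmax] using hb x y hx.1.le hx.2 hy0

lemma exists_hasFourierCoefs (hk : k ≠ 1) (h : IsHarmonic k (ext f))
    (hper : ∀ z, ext f (z + 1) = ext f z) (hg : ModerateGrowth k f) :
    ∃ ap am : ℕ → ℂ, HasFourierCoefs k f ap am := by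
  have hode := isCoefODE_fourierCoef h hper hg
  have hpos : ∀ n : ℕ, ∃ a : ℂ, ∀ y : ℝ, 0 < y →
      fourierCoef (coord f) (n + 1) y = a * kernelPlus (2 * Real.pi * (n + 1 : ℕ) * y) := by
    intro n
    have h1 := hode (n + 1)
    rw [show 2 * Real.pi * ((n + 1 : ℤ) : ℝ) = 2 * Real.pi * (n + 1 : ℕ) by push_cast; ring] at h1
    exact h1.exists_eq_kernelPlus (by positivity)
  have hneg : ∀ n : ℕ, ∃ a : ℂ, ∀ y : ℝ, 0 < y →
      fourierCoef (coord f) (-(n + 1)) y = a * kernelMinus k (2 * Real.pi * (n + 1 : ℕ) * y) := by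
    intro n
    have h1 := hode (-(n + 1))
    rw [show 2 * Real.pi * ((-(n + 1) : ℤ) : ℝ) = -(2 * Real.pi * (n + 1 : ℕ)) by
      push_cast; ring] at h1
    exact h1.exists_eq_kernelMinus (by positivity)
  have hzero : ∃ a b : ℂ, ∀ y : ℝ, 0 < y →
      fourierCoef (coord f) 0 y = a + b * ((y ^ (1 - k) : ℝ) : ℂ) := by
    have h1 := hode 0
    rw [Int.cast_zero, mul_zero] at h1
    exact h1.exists_eq_zero_frequency hk
  choose p hp using hpos
  choose q hq using hneg
  obtain ⟨a, b, hab⟩ := hzero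
  refine ⟨fun n => n.casesOn a p, fun n => n.casesOn b q, fun j y hy => ?_⟩
  rcases lt_trichotomy j 0 with hj | rfl | hj
  · obtain ⟨n, rfl⟩ : ∃ n : ℕ, j = -(n + 1) := ⟨(-j - 1).toNat, by omega⟩
    rw [hq n y hy, expansionCoef_neg_add_one]
  · rw [hab y hy]; simp [expansionCoef]
  · obtain ⟨n, rfl⟩ : ∃ n : ℕ, j = n + 1 := ⟨(j - 1).toNat, by omega⟩
    rw [hp n y hy, expansionCoef_add_one]

end existence

/-! ### The Fricke involution -/

lemma dbar_mul_comp {φ w F : ℂ → ℂ} {z φ' w' : ℂ} (hφ : HasDerivAt φ φ' z)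
    (hw : HasDerivAt w w' z) (hF : DifferentiableAt ℝ F (w z)) :
    dbar (fun z => φ z * F (w z)) z = φ z * (starRingEnd ℂ) w' * dbar F (w z) := by
  have hL : ∀ (L : ℂ →L[ℝ] ℂ) (a : ℂ), L a = a.re * L 1 + a.im * L I := by
    intro L a
    conv_lhs => rw [← re_add_im a]
    rw [map_add, show (a.re : ℂ) = a.re • (1 : ℂ) by simp,
      show (a.im : ℂ) * I = a.im • I by simp, map_smul, map_smul]
    simp
  have h1 := hφ.complexToReal_fderiv.mul
    (hF.hasFDerivAt.comp z hw.complexToReal_fderiv)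
  have h2 : HasFDerivAt (fun z => φ z * F (w z)) _ z := h1
  rw [dbar, h2.fderiv]
  simp only [add_apply, smul_apply, ContinuousLinearMap.coe_comp, Function.comp_apply,
    one_apply_eq_self, smul_eq_mul, dbar]
  rw [hL _ (w' * 1), hL _ (w' * I)]
  have hw' : (starRingEnd ℂ) w' = w'.re - w'.im * I := by
    apply Complex.ext <;> simp
  rw [hw']
  simp only [mul_one, mul_re, mul_im, I_re, I_im, mul_zero, zero_sub, ofReal_neg,
    add_zero]
  linear_combination (F (w z) * φ' + φ z * w'.im * fderiv ℝ F (w z) I) * I_mul_I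

lemma conj_cpow_neg {u : ℂ} (hu : u ≠ 0) (k : ℝ) :
    (starRingEnd ℂ) (u ^ (-(k : ℂ))) = ((‖u‖ ^ (-(2 * k)) : ℝ) : ℂ) * u ^ (k : ℂ) := by
  have hn : 0 < ‖u‖ := norm_pos_iff.2 hu
  have h0 : u ^ (-(k : ℂ)) ≠ 0 := by simp [cpow_eq_zero_iff, hu]
  have h1 : u ^ (-(k : ℂ)) * u ^ (k : ℂ) = 1 := by
    rw [← cpow_add _ _ hu]; simp
  have h2 : u ^ (-(k : ℂ)) * (starRingEnd ℂ) (u ^ (-(k : ℂ)))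
      = ((‖u‖ ^ (-(2 * k)) : ℝ) : ℂ) := by
    rw [mul_conj, normSq_eq_norm_sq, ← ofReal_neg, norm_cpow_real, ← Real.rpow_natCast,
      ← Real.rpow_mul hn.le]
    congr 2; push_cast; ring
  refine mul_left_cancel₀ h0 ?_
  linear_combination h2 - (((‖u‖ ^ (-(2 * k)) : ℝ) : ℂ)) * h1

lemma IsHarmonic.congr {k : ℝ} {F G : ℂ → ℂ} (h : IsHarmonic k F)
    (hFG : ∀ z ∈ upperHalf, G z = F z) : IsHarmonic k G := by
  refine ⟨h.contDiffOn.congr hFG, h.holo.congr fun z hz => ?_⟩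
  have : G =ᶠ[𝓝 z] F := by
    filter_upwards [isOpen_upperHalf.mem_nhds hz] with w hw using hFG w hw
  rw [shadow, shadow, dbar, dbar, this.fderiv_eq]

/-- With `w = -1/(Nz)`, the conjugate of the shadow of `g` is `N^{-k/2} (Nz)^k w'(z)` times the one
of `f` at `w`. -/
lemma isHarmonic_fricke {k : ℝ} {N : ℕ} (hN : 0 < N) {F : ℂ → ℂ} (h : IsHarmonic k F) :
    IsHarmonic k fun z => ((N : ℂ) ^ ((k : ℂ) / 2) * ((N : ℂ) * z) ^ (-(k : ℂ)))
      * F (-1 / ((N : ℂ) * z)) := by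
  have hN' : (0 : ℝ) < N := by exact_mod_cast hN
  have hNc : (N : ℂ) ≠ 0 := by exact_mod_cast hN.ne'
  have hz0 : ∀ {z : ℂ}, z ∈ upperHalf → z ≠ 0 := by
    rintro z hz rfl
    simp [upperHalf] at hz
  have hslit : ∀ {z : ℂ}, z ∈ upperHalf → (N : ℂ) * z ∈ slitPlane := by
    intro z hz
    right
    have : 0 < z.im := hz
    simp [this.ne', hN.ne']
  have hwU : ∀ {z : ℂ}, z ∈ upperHalf → -1 / ((N : ℂ) * z) ∈ upperHalf := by
    intro z hz
    have h1 : 0 < ‖z‖ := norm_pos_iff.2 (hz0 hz)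
    have h2 : 0 < z.im := hz
    change 0 < (-1 / ((N : ℂ) * z)).im
    rw [im_neg_one_div]
    positivity
  have hw : ∀ {z : ℂ}, z ∈ upperHalf →
      HasDerivAt (fun z : ℂ => -1 / ((N : ℂ) * z)) (1 / (N * z ^ 2)) z := by
    intro z hz
    have h1 := (hasDerivAt_inv (hz0 hz)).const_mul (-1 / (N : ℂ))
    refine (h1.congr_of_eventuallyEq (Eventually.of_forall fun z => ?_)).congr_deriv ?_
    · simp only [div_eq_mul_inv, mul_inv, mul_assoc]
    · have := hz0 hz
      field_simp
  have hpow : ∀ (s : ℂ) {z : ℂ}, z ∈ upperHalf →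
      DifferentiableAt ℂ (fun z : ℂ => ((N : ℂ) * z) ^ s) z := fun s z hz =>
    (differentiableAt_id.const_mul (N : ℂ)).cpow_const (hslit hz)
  have hφ : ∀ {z : ℂ}, z ∈ upperHalf → DifferentiableAt ℂ
      (fun z : ℂ => (N : ℂ) ^ ((k : ℂ) / 2) * ((N : ℂ) * z) ^ (-(k : ℂ))) z := fun hz =>
    (hpow _ hz).const_mul _
  constructor
  · have c1 : ContDiffOn ℝ 2
        (fun z : ℂ => (N : ℂ) ^ ((k : ℂ) / 2) * ((N : ℂ) * z) ^ (-(k : ℂ))) upperHalf :=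
      (DifferentiableOn.contDiffOn (fun z hz => (hφ hz).differentiableWithinAt)
        isOpen_upperHalf).restrict_scalars ℝ
    have c2 : ContDiffOn ℝ 2 (fun z : ℂ => -1 / ((N : ℂ) * z)) upperHalf :=
      (DifferentiableOn.contDiffOn (fun z hz => (hw hz).differentiableAt.differentiableWithinAt)
        isOpen_upperHalf).restrict_scalars ℝ
    exact c1.mul (h.contDiffOn.comp c2 fun z hz => hwU hz)
  · have key : DifferentiableOn ℂ (fun z : ℂ =>
        ((N : ℝ) ^ (-(k / 2)) : ℝ) * ((N : ℂ) * z) ^ (k : ℂ) * (1 / (N * z ^ 2))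
          * (starRingEnd ℂ) (shadow k F (-1 / ((N : ℂ) * z)))) upperHalf := by
      intro z hz
      have d1 : DifferentiableAt ℂ (fun z : ℂ => 1 / ((N : ℂ) * z ^ 2)) z :=
        (differentiableAt_const _).div (by fun_prop)
          (mul_ne_zero hNc (pow_ne_zero 2 (hz0 hz)))
      have d2 : DifferentiableAt ℂ
          (fun z : ℂ => (starRingEnd ℂ) (shadow k F (-1 / ((N : ℂ) * z)))) z :=
        DifferentiableAt.comp z (g := fun w => (starRingEnd ℂ) (shadow k F w))
          ((h.holo _ (hwU hz)).differentiableAt (isOpen_upperHalf.mem_nhds (hwU hz)))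
          (hw hz).differentiableAt
      exact ((((hpow _ hz).const_mul _).mul d1).mul d2).differentiableWithinAt
    refine key.congr fun z hz => ?_
    have hy : 0 < z.im := hz
    have hn : 0 < ‖z‖ := norm_pos_iff.2 (hz0 hz)
    rw [shadow, shadow, dbar_mul_comp (hφ hz).hasDerivAt (hw hz)
      (differentiableAt_of_contDiffOn two_ne_zero h.contDiffOn (hwU hz))]
    have hNk : (N : ℂ) ^ ((k : ℂ) / 2) = (((N : ℝ) ^ (k / 2) : ℝ) : ℂ) := by
      rw [ofReal_cpow (by positivity)]; push_cast; rfl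
    simp only [map_mul, conj_ofReal, conj_conj, hNk,
      conj_cpow_neg (mul_ne_zero hNc (hz0 hz))]
    have hreal : z.im ^ k * (N : ℝ) ^ (k / 2) * ‖(N : ℂ) * z‖ ^ (-(2 * k))
        = (N : ℝ) ^ (-(k / 2)) * (-1 / ((N : ℂ) * z)).im ^ k := by
      rw [im_neg_one_div, norm_mul, norm_natCast, Real.mul_rpow hN'.le hn.le,
        Real.div_rpow hy.le (by positivity), Real.mul_rpow hN'.le (by positivity),
        ← Real.rpow_natCast ‖z‖ 2, ← Real.rpow_mul hn.le, Real.rpow_neg hn.le,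
        div_mul_eq_div_div, div_eq_mul_inv _ ((N : ℝ) ^ k), ← Real.rpow_neg hN'.le k]
      have e : (N : ℝ) ^ (k / 2) * (N : ℝ) ^ (-(2 * k))
          = (N : ℝ) ^ (-(k / 2)) * (N : ℝ) ^ (-k) := by
        rw [← Real.rpow_add hN', ← Real.rpow_add hN']; congr 1; ring
      have e' : ((2 : ℕ) : ℝ) * k = 2 * k := by norm_num
      rw [e', div_eq_mul_inv _ (‖z‖ ^ (2 * k))]
      linear_combination (z.im ^ k * (‖z‖ ^ (2 * k))⁻¹) * e
    have hc := congrArg ((↑) : ℝ → ℂ) hreal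
    simp only [ofReal_mul] at hc
    linear_combination (((N : ℂ) * z) ^ (k : ℂ) * (1 / (N * z ^ 2))
      * (starRingEnd ℂ) (dbar F (-1 / ((N : ℂ) * z)))) * hc

/-! ### Periodicity -/

lemma slashFactor_one_right (m c : ℤ) : slashFactor m c 1 = 1 := by
  simp [slashFactor, kroneckerOdd, epsilonOdd]

lemma ext_add_one {f : ℍ → ℂ} (h : ∀ τ : ℍ, f ((1 : ℝ) +ᵥ τ) = f τ) (z : ℂ) :
    ext f (z + 1) = ext f z := by
  by_cases hz : 0 < z.im
  · have hz1 : 0 < (z + 1).im := by simpa using hz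
    rw [ext, ext, UpperHalfPlane.ofComplex_apply_of_im_pos hz,
      UpperHalfPlane.ofComplex_apply_of_im_pos hz1, ← h ⟨z, hz⟩]
    congr 1
    ext
    simp [add_comm]
  · rw [ext, ext, UpperHalfPlane.ofComplex_apply_eq_of_im_nonpos (w := z + 1) (w' := z)
      (by simpa using hz) (not_lt.1 hz)]

section form

variable {m : ℤ} {N : ℕ} {χ : CongruenceSubgroup.Gamma0 N →* Circle} {f : ℍ → ℂ}

/-- Invariance under `γ ∈ Γ₀(N)` with lower right entry `1` and `χ(γ) = 1`. -/
lemma IsHarmonicMaassForm.plainSlash_eq (hf : IsHarmonicMaassForm m N χ f)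
    (γ : CongruenceSubgroup.Gamma0 N) (hγ : χ γ = 1) (hd : (γ : SL(2, ℤ)) 1 1 = 1) (τ : ℍ) :
    plainSlash ((m : ℝ) / 2) f (γ : SL(2, ℤ)) τ = f τ := by
  have h := hf.transform γ τ
  rwa [slash, hd, slashFactor_one_right, one_mul, hγ, Circle.coe_one, one_mul] at h

lemma IsHarmonicMaassForm.vadd_one (hf : IsHarmonicMaassForm m N χ f)
    (hχ : ∀ γ : CongruenceSubgroup.Gamma0 N,
      ((γ : SL(2, ℤ)) : Matrix (Fin 2) (Fin 2) ℤ) = !![1, 1; 0, 1] → χ γ = 1) (τ : ℍ) :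
    f ((1 : ℝ) +ᵥ τ) = f τ := by
  have hT : ModularGroup.T ∈ CongruenceSubgroup.Gamma0 N := by
    rw [CongruenceSubgroup.Gamma0_mem]; simp [ModularGroup.T]
  have h := hf.plainSlash_eq ⟨ModularGroup.T, hT⟩ (hχ _ rfl) (by simp [ModularGroup.T]) τ
  rw [plainSlash] at h
  simp only [UpperHalfPlane.modular_T_smul] at h
  simpa [ModularGroup.T] using h

/-- The lower triangular matrix with bottom row `(N, 1)`. -/
def lowerUnipotent (N : ℤ) : SL(2, ℤ) := ⟨!![1, 0; N, 1], by simp⟩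

/-- `(τ + 1)^s = τ^s (τ / (τ + 1))^{-s}` for the principal powers. -/
lemma add_one_cpow_neg (τ : ℍ) (s : ℂ) :
    ((τ : ℂ) + 1) ^ (-s) = (τ : ℂ) ^ (-s) * (τ / ((τ : ℂ) + 1)) ^ s := by
  have hτ := τ.ne_zero
  have him : 0 < (τ : ℂ).im := τ.im_pos
  have hτ1 : (τ : ℂ) + 1 ≠ 0 := by
    intro h
    have := congrArg Complex.im h
    simp at this
    exact τ.im_ne_zero this
  set v : ℂ := ((τ : ℂ) + 1) / τ with hv
  have hv0 : v ≠ 0 := div_ne_zero hτ1 hτ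
  have hvim : v.im < 0 := by
    have e : v = 1 + (τ : ℂ)⁻¹ := by rw [hv]; field_simp
    rw [e, add_im, one_im, zero_add, inv_im]
    have := normSq_pos.2 hτ
    rw [neg_div]
    exact neg_neg_of_pos (by positivity)
  have hargv : v.arg < 0 := arg_neg_iff.2 hvim
  have harg : (τ : ℂ).arg + v.arg ∈ Set.Ioc (-Real.pi) Real.pi :=
    ⟨by linarith [neg_pi_lt_arg v, arg_nonneg_iff.2 him.le], by linarith [arg_le_pi (τ : ℂ)]⟩
  have e1 : (τ : ℂ) + 1 = τ * v := by rw [hv]; field_simp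
  have e2 : (τ : ℂ) / ((τ : ℂ) + 1) = v⁻¹ := by rw [hv, inv_div]
  rw [e2, inv_cpow _ _ (by linarith [Real.pi_pos] : v.arg < Real.pi).ne, ← cpow_neg]
  rw [← mul_cpow_of_arg_add_mem hτ hv0 harg, ← e1]

lemma IsHarmonicMaassForm.fricke_vadd_one (hN : 0 < N) (hf : IsHarmonicMaassForm m N χ f)
    (hχ : ∀ γ : CongruenceSubgroup.Gamma0 N,
      ((γ : SL(2, ℤ)) : Matrix (Fin 2) (Fin 2) ℤ) = !![1, 0; (N : ℤ), 1] → χ γ = 1) (τ : ℍ) :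
    fricke ((m : ℝ) / 2) N f ((1 : ℝ) +ᵥ τ) = fricke ((m : ℝ) / 2) N f τ := by
  have hNc : (N : ℂ) ≠ 0 := by exact_mod_cast hN.ne'
  have hτ := τ.ne_zero
  have hU : lowerUnipotent N ∈ CongruenceSubgroup.Gamma0 N := by
    rw [CongruenceSubgroup.Gamma0_mem]; simp [lowerUnipotent]
  set τ' : ℍ := (1 : ℝ) +ᵥ τ with hτ'
  have hτ'c : (τ' : ℂ) = τ + 1 := by rw [hτ', UpperHalfPlane.coe_vadd]; push_cast; ring
  have hτ1 : (τ : ℂ) + 1 ≠ 0 := hτ'c ▸ τ'.ne_zero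
  have h := hf.plainSlash_eq ⟨lowerUnipotent N, hU⟩ (hχ _ rfl) (by simp [lowerUnipotent])
    (frickePoint N τ')
  -- the matrix maps `-1/(N(τ+1))` to `-1/(Nτ)`
  have hpt : lowerUnipotent N • frickePoint N τ' = frickePoint N τ := by
    ext
    rw [UpperHalfPlane.coe_specialLinearGroup_apply, coe_frickePoint hN, coe_frickePoint hN, hτ'c]
    have h2 : (N : ℂ) * (-1 / (N * (τ + 1))) + 1 = τ / (τ + 1) := by
      field_simp
      ring
    simp [lowerUnipotent]
    rw [h2]
    field_simp
  have hden : (((lowerUnipotent N) 1 0 : ℤ) : ℂ) * (frickePoint N τ' : ℂ)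
      + (((lowerUnipotent N) 1 1 : ℤ) : ℂ) = τ / (τ + 1) := by
    rw [coe_frickePoint hN, hτ'c]
    simp [lowerUnipotent]
    field_simp
    ring
  rw [plainSlash] at h
  simp only [hpt, hden] at h
  have hNr : (0 : ℝ) < N := by exact_mod_cast hN
  rw [fricke, fricke, ← frickePoint, ← frickePoint, ← h, hτ'c, ← ofReal_natCast,
    ofReal_mul_cpow hNr hτ1, ofReal_mul_cpow hNr hτ, add_one_cpow_neg, cpow_neg (_ / _)]
  have h0 : (τ / ((τ : ℂ) + 1)) ^ ((((m : ℝ) / 2 : ℝ)) : ℂ) ≠ 0 := by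
    simp [cpow_eq_zero_iff, hτ, hτ1]
  field_simp

lemma IsHarmonicMaassForm.isHarmonic (hf : IsHarmonicMaassForm m N χ f) :
    IsHarmonic ((m : ℝ) / 2) (ext f) :=
  isHarmonic_ext_of_hypLaplacian (hf.smooth.of_le (WithTop.coe_le_coe.2 le_top)) hf.harmonic

lemma isHarmonic_ext_fricke {k : ℝ} (hN : 0 < N) (h : IsHarmonic k (ext f)) :
    IsHarmonic k (ext (fricke k N f)) := by
  refine (isHarmonic_fricke hN h).congr fun z hz => ?_
  have hz : 0 < z.im := hz
  rw [ext, UpperHalfPlane.ofComplex_apply_of_im_pos hz, fricke, ext]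

end form

lemma IsHarmonic.continuous {k : ℝ} {f : ℍ → ℂ} (h : IsHarmonic k (ext f)) : Continuous f := by
  have h := h.contDiffOn.continuousOn.comp_continuous UpperHalfPlane.continuous_coe
    fun τ : ℍ => τ.im_pos
  simpa [Function.comp_def, ext] using! h

lemma continuousOn_axis {N : ℕ} (hN : 0 < N) {f : ℍ → ℂ} (h : ContinuousOn (ext f) upperHalf) :
    ContinuousOn (axis N f) (Set.Ioi 0) := by
  have hsN : 0 < √(N : ℝ) := Real.sqrt_pos.2 (by exact_mod_cast hN)
  refine h.comp (f := fun y : ℝ => ((y / √N : ℝ) : ℂ) * I) (by fun_prop) fun y hy => ?_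
  have hy : 0 < y := hy
  change 0 < (((y / √N : ℝ) : ℂ) * I).im
  simp
  positivity

/-! ### The meromorphic continuation -/

lemma exists_hasExpansion {k : ℝ} {f : ℍ → ℂ} (hk : k ≠ 1) (h : IsHarmonic k (ext f))
    (hper : ∀ τ : ℍ, f ((1 : ℝ) +ᵥ τ) = f τ) (hg : ModerateGrowth k f) :
    ∃ ap am : ℕ → ℂ, HasExpansion k f ap am := by
  obtain ⟨ap, am, hc⟩ := exists_hasFourierCoefs hk h (ext_add_one hper) hg
  refine ⟨ap, am, hc.hasExpansion hg h.continuous fun x y _ => ?_⟩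
  have := ext_add_one hper (x + y * I)
  rw [ext, ext] at this
  rw [coord, coord, ← this]
  congr 2; push_cast; ring

lemma isFEPair_axis {k : ℝ} {N : ℕ} (hN : 0 < N) {f : ℍ → ℂ} (h : IsHarmonic k (ext f))
    {ap am bp bm : ℕ → ℂ} (hf : HasExpansion k f ap am) (hg : HasExpansion k (fricke k N f) bp bm)
    {μ₁ μ₂ μ₃ μ₄ : ℝ} (h₁ : PolyBound ap μ₁) (h₂ : PolyBound am μ₂) (h₃ : PolyBound bp μ₃)
    (h₄ : PolyBound bm μ₄) :
    IsFEPair k (I ^ (k : ℂ)) (axis N f) (axis N (fricke k N f))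
      (ap 0) (am 0 * (N : ℂ) ^ (((k : ℂ) - 1) / 2))
      (bp 0) (bm 0 * (N : ℂ) ^ (((k : ℂ) - 1) / 2)) where
  contF := continuousOn_axis hN h.contDiffOn.continuousOn
  contG := continuousOn_axis hN (isHarmonic_ext_fricke hN h).contDiffOn.continuousOn
  ne_zero := by simp [cpow_eq_zero_iff]
  map_inv _ hy := axis_inv hN f hy
  decayF := isBigO_subConst_axis hN hf h₁ h₂
  decayG := isBigO_subConst_axis hN hg h₃ h₄

lemma IsFEPair.symm {k : ℝ} {ε : ℂ} {F G : ℝ → ℂ} {a₀ a₁ b₀ b₁ : ℂ}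
    (P : IsFEPair k ε F G a₀ a₁ b₀ b₁) : IsFEPair k ε⁻¹ G F b₀ b₁ a₀ a₁ where
  contF := P.contG
  contG := P.contF
  ne_zero := inv_ne_zero P.ne_zero
  decayF := P.decayG
  decayG := P.decayF
  map_inv y hy := by
    have h := P.map_inv y⁻¹ (by positivity)
    have hy' : (y : ℂ) ^ (k : ℂ) ≠ 0 := by simp [cpow_eq_zero_iff, hy.ne']
    have hε := P.ne_zero
    rw [inv_inv, ofReal_inv, inv_cpow _ _ (by rw [arg_ofReal_of_nonneg hy.le]; exact
      Real.pi_pos.ne)] at h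
    rw [h]
    field_simp

/-- The points at which poles are possible. -/
def polarSet (k : ℝ) : Set ℂ := {0, 1, (k : ℂ) - 1, (k : ℂ)}

open Classical in
/-- The continuation, corrected at those of the points `0, 1, k-1, k` that lie in a half-plane of
convergence, where the sum of polar terms has a junk value. -/
noncomputable def globalL (N : ℕ) (k : ℝ) (ap am : ℕ → ℂ) (Λ : ℂ → ℂ) (s : ℂ) : ℂ :=
  if s ∈ polarSet k then completedL N k ap am s else Λ s

lemma globalL_eventuallyEq {N : ℕ} {k : ℝ} {ap am : ℕ → ℂ} {Λ : ℂ → ℂ} (p : ℂ) :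
    globalL N k ap am Λ =ᶠ[𝓝[≠] p] Λ := by
  have hfin : (polarSet k).Finite := by simp [polarSet]
  have h : (polarSet k \ {p})ᶜ ∈ 𝓝 p :=
    (hfin.subset Set.sdiff_subset).isClosed.isOpen_compl.mem_nhds (by simp)
  filter_upwards [nhdsWithin_le_nhds h, self_mem_nhdsWithin] with s hs hsp
  rw [globalL, if_neg fun hmem => hs ⟨hmem, hsp⟩]

lemma globalL_eventuallyEq_nhds {N : ℕ} {k : ℝ} {ap am : ℕ → ℂ} {Λ : ℂ → ℂ} {s : ℂ}
    (hs : s ∉ polarSet k) : globalL N k ap am Λ =ᶠ[𝓝 s] Λ := by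
  have hfin : (polarSet k).Finite := by simp [polarSet]
  filter_upwards [hfin.isClosed.isOpen_compl.mem_nhds hs] with w hw
  rw [globalL, if_neg hw]

lemma isContinuation_globalL {N : ℕ} (hN : 0 < N) {k : ℝ} {f : ℍ → ℂ} {ap am : ℕ → ℂ}
    (hf : HasExpansion k f ap am) {ε : ℂ} {G : ℝ → ℂ} {b₀ b₁ : ℂ}
    (P : IsFEPair k ε (axis N f) G (ap 0) (am 0 * (N : ℂ) ^ (((k : ℂ) - 1) / 2)) b₀ b₁) :
    IsContinuation N k ap am (globalL N k ap am (continuation k ε (axis N f) G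
      (ap 0) (am 0 * (N : ℂ) ^ (((k : ℂ) - 1) / 2)) b₀ b₁)) := by
  refine ⟨fun s => (P.meromorphicAt_continuation s).congr (globalL_eventuallyEq s).symm,
    fun μp μm hp hm s hs => ?_⟩
  rw [globalL]
  split_ifs with hmem
  · rfl
  · refine (P.eq_continuation_of_eq (σ' := max (max (max (μp + 1) (μm + 1)) (max (k - 1) 0))
      (max 1 k)) (differentiableOn_completedL hN hp hm) (fun z hz => ?_) hs hmem).symm
    obtain ⟨hz1, hz2⟩ := max_lt_iff.1 hz
    obtain ⟨hz3, hz4⟩ := max_lt_iff.1 hz2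
    rw [← mellin_subConst_axis hN hf hp hm hz1, P.mellin_eq (by linarith) hz3 hz4]

end HMF

theorem mainTheorem9 (m : ℤ) (k : ℝ) (hk : k = (m : ℝ) / 2) (N : ℕ) (hN : 0 < N)
    (h4 : Odd m → 4 ∣ N)
    (χ : CongruenceSubgroup.Gamma0 N →* Circle)
    (hχ_inf : ∀ γ : CongruenceSubgroup.Gamma0 N,
      ((γ : SL(2, ℤ)) : Matrix (Fin 2) (Fin 2) ℤ) = !![1, 1; 0, 1] → χ γ = 1)
    (hχ_zero : ∀ γ : CongruenceSubgroup.Gamma0 N,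
      ((γ : SL(2, ℤ)) : Matrix (Fin 2) (Fin 2) ℤ) = !![1, 0; (N : ℤ), 1] → χ γ = 1)
    (f : ℍ → ℂ) (hf : HMF.IsHarmonicMaassForm m N χ f) :
    (k ≠ 1 → (∃ ap am : ℕ → ℂ, HMF.HasExpansion k f ap am) ∧
      ∃ bp bm : ℕ → ℂ, HMF.HasExpansion k (HMF.fricke k N f) bp bm) ∧
    ∀ ap am bp bm : ℕ → ℂ,
      HMF.HasExpansion k f ap am → HMF.HasExpansion k (HMF.fricke k N f) bp bm →
      ((∃ μ : ℝ, HMF.PolyBound ap μ) ∧ (∃ μ : ℝ, HMF.PolyBound am μ) ∧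
        (∃ μ : ℝ, HMF.PolyBound bp μ) ∧ (∃ μ : ℝ, HMF.PolyBound bm μ)) ∧
      ∃ F G : ℂ → ℂ,
        HMF.IsContinuation N k ap am F ∧ HMF.IsContinuation N k bp bm G ∧
        (∀ s ∉ ({0, 1, (k : ℂ) - 1, (k : ℂ)} : Set ℂ), AnalyticAt ℂ F s) ∧
        (∀ p : ℂ, Tendsto (fun s : ℂ => (s - p) * F s) (𝓝[≠] p)
          (𝓝 (HMF.residueAt N k (ap 0) (am 0) (bp 0) (bm 0) p))) ∧
        (∀ s ∉ ({0, 1, (k : ℂ) - 1, (k : ℂ)} : Set ℂ), F s = I ^ (k : ℂ) * G ((k : ℂ) - s)) := by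
  open HMF in
  have hHf : IsHarmonic k (ext f) := hk ▸ hf.isHarmonic
  have hHg : IsHarmonic k (ext (fricke k N f)) := isHarmonic_ext_fricke hN hHf
  have hGf : ModerateGrowth k f := hk ▸ hf.moderateGrowth hN
  have hGg : ModerateGrowth k (fricke k N f) := hk ▸ hf.moderateGrowth_fricke hN
  refine ⟨fun hk1 => ⟨exists_hasExpansion hk1 hHf (hf.vadd_one hχ_inf) hGf,
    exists_hasExpansion hk1 hHg (hk ▸ hf.fricke_vadd_one hN hχ_zero) hGg⟩,
    fun ap am bp bm ha hb => ?_⟩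
  obtain ⟨⟨μ₁, h₁⟩, ⟨μ₂, h₂⟩⟩ := ha.hasFourierCoefs.exists_polyBound hGf
  obtain ⟨⟨μ₃, h₃⟩, ⟨μ₄, h₄⟩⟩ := hb.hasFourierCoefs.exists_polyBound hGg
  have P := isFEPair_axis hN hHf ha hb h₁ h₂ h₃ h₄
  refine ⟨⟨⟨μ₁, h₁⟩, ⟨μ₂, h₂⟩, ⟨μ₃, h₃⟩, ⟨μ₄, h₄⟩⟩, _, _, isContinuation_globalL hN ha P,
    isContinuation_globalL hN hb P.symm, fun s hs => ?_, fun p => ?_, fun s hs => ?_⟩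
  · exact (P.analyticAt_continuation hs).congr (globalL_eventuallyEq_nhds hs).symm
  · have h := P.tendsto_residue p
    simp only [residueAt, mul_assoc, neg_mul] at h ⊢
    refine h.congr' ?_
    filter_upwards [globalL_eventuallyEq (N := N) (k := k) (ap := ap) (am := am) p] with s hs
    rw [hs]
  · have hs' : (k : ℂ) - s ∉ polarSet k := by
      simp only [polarSet, Set.mem_insert_iff, Set.mem_singleton_iff, not_or] at hs ⊢
      refine ⟨fun h => hs.2.2.2 (by linear_combination -h), fun h => hs.2.2.1
        (by linear_combination -h), fun h => hs.2.1 (by linear_combination -h),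
        fun h => hs.1 (by linear_combination -h)⟩
    have hs₀ : s ∉ polarSet k := hs
    rw [globalL, if_neg hs₀, globalL, if_neg hs', IsFEPair.continuation_eq P.ne_zero]
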